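/- Let $\Omega\subset\mathbb C^d$ be a bounded pseudoconvex domain (open, connected, nonempty). For $0\le q\le d$ let $L^\infty_{(0,q)}(\Omega)$ be the space of $(0,q)$-forms $\omega=\sum_{|J|=q}\omega_J\,d\bar z_J$ with coefficients in $L^\infty(\Omega)$, normed by $\|\omega\|_\infty=\max_J\|\omega_J\|_{L^\infty(\Omega)}$, and let $\bar\partial$ be taken in the sense of distributions on $\Omega$. Suppose that there are constants $E_q$, $1\le q\le d$, such that for every $1\le q\le d$ and every $\omega\in L^\infty_{(0,q)}(\Omega)$ with $\bar\partial\omega=0$ there is $u\in L^\infty_{(0,q-1)}(\Omega)$ with $\bar\partial u=\omega$ and $\|u\|_\infty\le E_q\|\omega\|_\infty$. Let $H^\infty(\Omega)$ be the space of bounded holomorphic functions $g$ on $\Omega$, with $\|g\|_\infty=\sup_\Omega|g|$, and let $A^1(\Omega)$ be the space of holomorphic functions on $\Omega$ which are $C^1$ up to the boundary, that is, which extend continuously to $\overline\Omega$ together with their first derivatives; put $\|\nabla f\|_\infty=\sup_{z\in\Omega}\big(\sum_{k=1}^d|\partial f/\partial z_k(z)|^2\big)^{1/2}$. Then there is a constant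 $C=C(d,\Omega)>0$ such that the following holds for all integers $N\ge2$, all $\delta>0$, and all $f_1,\dots,f_{N-1}\in A^1(\Omega)$, $f_N\in H^\infty(\Omega)$ with $$\sup_{z\in\Omega}\max_{1\le j\le N}|f_j(z)|\le 1,\qquad \inf_{z\in\Omega}\sum_{j=1}^N|f_j(z)|\ge\delta .$$ There are $g_1,\dots,g_N\in H^\infty(\Omega)$ such that $\sum_{j=1}^N f_jg_j=1$ on $\Omega$ and $$\max_{1\le j\le N}\|g_j\|_\infty\le C\,N^{4d+2}\,\frac{\max\{M,\ \delta^2/N^4\}^{d}}{\delta^{2d+1}},\qquad M:=\max_{1\le j\le N-1}\|\nabla f_j\|_\infty .$$ In particular, the bound is $C\,N^{4d+2}M^d/\delta^{2d+1}$ whenever $M\ge\delta^2/N^4$, and it is at most $C\,N^{4d+2}\max\{1,M\}^d/\delta^{2d+1}$ in all cases. -/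

import Mathlib

open MeasureTheory
open scoped ENNReal NNReal

noncomputable section

/-- A continuous function `ρ` on an open set `Ω ⊆ ℂ^d` is plurisubharmonic: it satisfies the
sub-mean value property on every closed complex disc `{z + τ w : |τ| ≤ 1}` contained in `Ω`. -/
def IsContinuousPSH {d : ℕ} (Ω : Set (Fin d → ℂ)) (ρ : (Fin d → ℂ) → ℝ) : Prop :=
  ContinuousOn ρ Ω ∧
    ∀ z w : Fin d → ℂ, (∀ τ : ℂ, ‖τ‖ ≤ 1 → z + τ • w ∈ Ω) →
      ρ z ≤ Real.circleAverage (fun τ : ℂ => ρ (z + τ • w)) 0 1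

/-- `Ω` is pseudoconvex: it is open and has a continuous plurisubharmonic exhaustion function. -/
def IsPseudoconvex {d : ℕ} (Ω : Set (Fin d → ℂ)) : Prop :=
  IsOpen Ω ∧ ∃ ρ : (Fin d → ℂ) → ℝ, IsContinuousPSH Ω ρ ∧
    ∀ c : ℝ, IsCompact {z | z ∈ Ω ∧ ρ z ≤ c}

/-- A (measurable) form `∑_J ω_J dz̄_J` on `ℂ^d`, given by its coefficients; `J` runs over the
sets of indices, and `dz̄_J` is the wedge product of the `dz̄_j`, `j ∈ J`, in increasing order. -/
abbrev BarForm (d : ℕ) : Type := Finset (Fin d) → (Fin d → ℂ) → ℂ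

/-- `ω ∈ L^∞_{(0,q)}(Ω)`: `ω` is homogeneous of bidegree `(0,q)` and its coefficients are
(measurable and) essentially bounded on `Ω`. -/
def MemLinfForm {d : ℕ} (Ω : Set (Fin d → ℂ)) (q : ℕ) (ω : BarForm d) : Prop :=
  (∀ J : Finset (Fin d), J.card ≠ q → ω J = 0) ∧
    ∀ J : Finset (Fin d), MemLp (ω J) ∞ (volume.restrict Ω)

/-- `‖ω‖_∞` on `Ω`: the maximum of the essential suprema of the coefficients. -/
def linfFormNorm {d : ℕ} (Ω : Set (Fin d → ℂ)) (ω : BarForm d) : ℝ≥0∞ :=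
  ⨆ J : Finset (Fin d), eLpNorm (ω J) ∞ (volume.restrict Ω)

/-- The Wirtinger derivative `∂φ/∂z̄_k = (∂φ/∂x_k + i ∂φ/∂y_k) / 2`. -/
def wirtingerBar {d : ℕ} (k : Fin d) (φ : (Fin d → ℂ) → ℂ) (z : Fin d → ℂ) : ℂ :=
  (1 / 2 : ℂ) * (fderiv ℝ φ z (Pi.single k 1) + Complex.I * fderiv ℝ φ z (Pi.single k Complex.I))

/-- The sign in `dz̄_k ∧ dz̄_{K ∖ {k}} = ± dz̄_K`, for `k ∈ K`. -/
def wedgeSign {d : ℕ} (k : Fin d) (K : Finset (Fin d)) : ℂ :=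
  (-1) ^ (K.filter (fun i => i < k)).card

/-- `∂̄u = ω` on `Ω` in the sense of distributions: for every `K`, the coefficient
`∑_{k ∈ K} ± ∂u_{K ∖ {k}}/∂z̄_k` of `dz̄_K` in `∂̄u` is `ω_K`, tested against `φ ∈ C_c^∞(Ω)`. -/
def WeakDbar {d : ℕ} (Ω : Set (Fin d → ℂ)) (u ω : BarForm d) : Prop :=
  ∀ (K : Finset (Fin d)) (φ : (Fin d → ℂ) → ℂ),
    ContDiff ℝ ((⊤ : ℕ∞) : WithTop ℕ∞) φ → HasCompactSupport φ → tsupport φ ⊆ Ω →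
      ∑ k ∈ K, wedgeSign k K * ∫ z in Ω, u (K.erase k) z * wirtingerBar k φ z
        = - ∫ z in Ω, ω K z * φ z

/-- For `1 ≤ q ≤ d`, every `∂̄`-closed `ω ∈ L^∞_{(0,q)}(Ω)` is `∂̄u` for some
`u ∈ L^∞_{(0,q-1)}(Ω)` with `‖u‖_∞ ≤ E_q ‖ω‖_∞`. -/
def HasBoundedDbarSolutions {d : ℕ} (Ω : Set (Fin d → ℂ)) (E : ℕ → ℝ≥0) : Prop :=
  ∀ q : ℕ, 1 ≤ q → q ≤ d → ∀ ω : BarForm d, MemLinfForm Ω q ω → WeakDbar Ω ω 0 →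
    ∃ u : BarForm d, MemLinfForm Ω (q - 1) u ∧ WeakDbar Ω u ω ∧
      linfFormNorm Ω u ≤ (E q : ℝ≥0∞) * linfFormNorm Ω ω

/-- `f ∈ H^∞(Ω)`: bounded and holomorphic on `Ω`. -/
def IsHInfty {d : ℕ} (Ω : Set (Fin d → ℂ)) (f : (Fin d → ℂ) → ℂ) : Prop :=
  DifferentiableOn ℂ f Ω ∧ ∃ B : ℝ, ∀ z ∈ Ω, ‖f z‖ ≤ B

/-- `f ∈ A^1(Ω)`: holomorphic on `Ω`, and `C^1` up to the boundary, that is, `f` and its first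
derivative extend continuously to the closure of `Ω`. -/
def IsA1 {d : ℕ} (Ω : Set (Fin d → ℂ)) (f : (Fin d → ℂ) → ℂ) : Prop :=
  DifferentiableOn ℂ f Ω ∧
    (∃ F : (Fin d → ℂ) → ℂ, ContinuousOn F (closure Ω) ∧ ∀ z ∈ Ω, F z = f z) ∧
    ∃ F' : (Fin d → ℂ) → ((Fin d → ℂ) →L[ℂ] ℂ),
      ContinuousOn F' (closure Ω) ∧ ∀ z ∈ Ω, F' z = fderiv ℂ f z

/-- `‖g‖_∞ = sup_Ω |g|` (meaningful for `g` bounded on `Ω`). -/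
def supNorm {d : ℕ} (Ω : Set (Fin d → ℂ)) (g : (Fin d → ℂ) → ℂ) : ℝ :=
  ⨆ z : Ω, ‖g z‖

/-- `‖∇f‖_∞ = sup_Ω (∑_k |∂f/∂z_k|^2)^{1/2}` for `f` holomorphic with bounded derivatives. -/
def gradSupNorm {d : ℕ} (Ω : Set (Fin d → ℂ)) (f : (Fin d → ℂ) → ℂ) : ℝ :=
  ⨆ z : Ω, Real.sqrt (∑ k : Fin d, ‖fderiv ℂ f z (Pi.single k 1)‖ ^ 2)

/-- `max_{1 ≤ j ≤ N-1} ‖∇f_j‖_∞`: all the functions but the last one. -/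
def maxGradSupNorm {d : ℕ} (Ω : Set (Fin d → ℂ)) {N : ℕ} (f : Fin N → (Fin d → ℂ) → ℂ) : ℝ :=
  ⨆ j : {j : Fin N // (j : ℕ) + 1 < N}, gradSupNorm Ω (f j)

end

/-!
The proof solves `∑ f_j φ_j = 1` smoothly and corrects the solution through the Koszul complex.

*The smooth solution* (`exists_smooth_bezout`). With `s = ∑_{j<N} |f_j|²` and a smooth `η` equal to
`1/s` for `s` above a threshold `σ` comparable to `δ²/N`, put `φ_j = conj (f_j) η(s)` for `j < N`
and `φ_N = (1 - s η(s)) / f_N`. Where `1 - s η(s)` does not vanish, `s < σ`, so that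
`|f_N| ≥ δ/2`. Thus `∂̄φ` involves the derivatives of `f_1, …, f_{N-1}` only, and `|φ| ≲ N/δ`,
`|∂̄φ| ≲ N² M/δ²`.

*The Koszul forms*. Consider forms with values in the exterior algebra of `ℂ^N`, let
`Φ = ∑ φ_j e_j`, and let `P` be the contraction with `f`. The forms `a_n = Φ ∧ (∂̄Φ)^n`
(`koszulForm`) satisfy `∂̄a_n = (∂̄Φ)^{n+1} = P a_{n+1}` and `P a_0 = 1` (`dbarV_koszulForm`,
`contract_koszulForm`), because `P Φ = 1` and `P ∂̄Φ = 0`. Everything is expressed by creation and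
annihilation operators, so that all signs come from the canonical anticommutation relations.

*The descent* (`exists_descent`). The form `w_d = a_d` is `∂̄`-closed for degree reasons. If
`w_{q+1}` is `∂̄`-closed with `P w_{q+1} = P a_{q+1}`, solve `∂̄u = w_{q+1}` with bounds and put
`w_q = a_q - P u`; since `P ∂̄u = P a_{q+1} = ∂̄a_q` and `P² = 0`, it has the same properties. Each
step costs a factor comparable to `N`, and `a_q` is of size `(N²/δ) (N³ M/δ²)^q`, so `w_0` is of
size `(N²/δ) max (1, N⁴ M/δ²)^d`, which is the asserted bound. The components of `w_0` are weakly
holomorphic, hence holomorphic by Weyl's lemma (`exists_holomorphic_of_weak`), and `P w_0 = 1`.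
-/

/-! ### Creation and annihilation operators on functions of finite sets -/

section Fermions

variable {n : ℕ} {M : Type*} [AddCommGroup M] [Module ℂ M]

lemma wedgeSign_mul_self (i : Fin n) (S : Finset (Fin n)) : wedgeSign i S * wedgeSign i S = 1 := by
  rw [wedgeSign, ← mul_pow]; simp

lemma norm_wedgeSign (i : Fin n) (S : Finset (Fin n)) : ‖wedgeSign i S‖ = 1 := by
  simp [wedgeSign]

lemma wedgeSign_erase_self (i : Fin n) (S : Finset (Fin n)) :
    wedgeSign i (S.erase i) = wedgeSign i S := by
  rw [wedgeSign, wedgeSign, Finset.filter_erase, Finset.erase_eq_of_notMem (by simp)]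

lemma wedgeSign_insert_self (i : Fin n) (S : Finset (Fin n)) :
    wedgeSign i (insert i S) = wedgeSign i S := by
  rw [wedgeSign, wedgeSign, Finset.filter_insert, if_neg (lt_irrefl i)]

lemma wedgeSign_insert {i j : Fin n} {S : Finset (Fin n)} (hj : j ∉ S) :
    wedgeSign i (insert j S) = (if j < i then -1 else 1) * wedgeSign i S := by
  rw [wedgeSign, wedgeSign, Finset.filter_insert]
  split_ifs with h
  · rw [Finset.card_insert_of_notMem (by simp [hj]), pow_succ]; ring
  · simp

/-- Left multiplication by the `i`-th generator of the exterior algebra on `n` generators with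
coefficients in `M`, an element being given by its coefficients on the increasing monomials. -/
def cre (i : Fin n) : (Finset (Fin n) → M) →ₗ[ℂ] (Finset (Fin n) → M) where
  toFun u S := if i ∈ S then wedgeSign i S • u (S.erase i) else 0
  map_add' u v := by ext S; by_cases h : i ∈ S <;> simp [h]
  map_smul' c u := by ext S; by_cases h : i ∈ S <;> simp [h, smul_comm c]

/-- Contraction with the `i`-th generator, the adjoint of `cre i`. -/
def ann (i : Fin n) : (Finset (Fin n) → M) →ₗ[ℂ] (Finset (Fin n) → M) where
  toFun u S := if i ∈ S then 0 else wedgeSign i S • u (insert i S)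
  map_add' u v := by ext S; by_cases h : i ∈ S <;> simp [h]
  map_smul' c u := by ext S; by_cases h : i ∈ S <;> simp [h, smul_comm c]

lemma cre_apply (i : Fin n) (u : Finset (Fin n) → M) (S : Finset (Fin n)) :
    cre i u S = if i ∈ S then wedgeSign i S • u (S.erase i) else 0 := rfl

lemma ann_apply (i : Fin n) (u : Finset (Fin n) → M) (S : Finset (Fin n)) :
    ann i u S = if i ∈ S then 0 else wedgeSign i S • u (insert i S) := rfl

/-- Inserting two elements in either order produces opposite signs. -/
lemma wedgeSign_insert_swap {i j : Fin n} (hij : i ≠ j) {S : Finset (Fin n)} (hi : i ∉ S)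
    (hj : j ∉ S) :
    wedgeSign i (insert j S) * wedgeSign j S = -(wedgeSign j (insert i S) * wedgeSign i S) := by
  rw [wedgeSign_insert hj, wedgeSign_insert hi]
  rcases lt_or_gt_of_ne hij with h | h
  · simp [h, h.not_gt]; ring
  · simp [h, h.not_gt]; ring

lemma ann_ann (i j : Fin n) (u : Finset (Fin n) → M) : ann i (ann j u) = -ann j (ann i u) := by
  ext S
  by_cases hi : i ∈ S
  · simp [ann_apply, hi]
  by_cases hj : j ∈ S
  · simp [ann_apply, hj]
  by_cases hij : i = j
  · subst hij; simp [ann_apply]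
  · have hji : j ≠ i := fun h => hij h.symm
    simp only [ann_apply, Pi.neg_apply, hi, hj, hij, hji, Finset.mem_insert, or_self, if_false,
      smul_smul]
    rw [← neg_smul, Finset.insert_comm i j S, mul_comm, wedgeSign_insert_swap hji hj hi, mul_comm]

lemma cre_cre (i j : Fin n) (u : Finset (Fin n) → M) : cre i (cre j u) = -cre j (cre i u) := by
  ext S
  by_cases hij : i = j
  · subst hij; simp [cre_apply]
  have hji : j ≠ i := fun h => hij h.symm
  by_cases hi : i ∈ S
  · by_cases hj : j ∈ S
    · simp only [cre_apply, Pi.neg_apply, hi, hj, hij, hji, Finset.mem_erase, if_true, ne_eq,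
        not_false_eq_true, and_self, smul_smul]
      rw [← neg_smul, Finset.erase_right_comm]
      obtain ⟨T, hiT, hjT, rfl⟩ : ∃ T, i ∉ T ∧ j ∉ T ∧ S = insert i (insert j T) := by
        refine ⟨(S.erase i).erase j, by simp, by simp, ?_⟩
        rw [Finset.insert_erase (by simp [hji, hj]), Finset.insert_erase hi]
      congr 1
      have h1 : (insert i (insert j T)).erase i = insert j T :=
        Finset.erase_insert (by simp [hij, hiT])
      have h2 : (insert i (insert j T)).erase j = insert i T := by
        rw [Finset.insert_comm]; exact Finset.erase_insert (by simp [hji, hjT])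
      rw [h1, h2, wedgeSign_insert_self, Finset.insert_comm i j, wedgeSign_insert_self,
        wedgeSign_insert_self, wedgeSign_insert_self, wedgeSign_insert_swap hij hiT hjT]
    · simp [cre_apply, hj]
  · simp [cre_apply, hi]

/-- The canonical anticommutation relations. -/
lemma ann_cre (i j : Fin n) (u : Finset (Fin n) → M) :
    ann i (cre j u) = (if i = j then u else 0) - cre j (ann i u) := by
  ext S
  by_cases hij : i = j
  · subst hij
    by_cases hi : i ∈ S
    · simp [cre_apply, ann_apply, hi, wedgeSign_erase_self, smul_smul, wedgeSign_mul_self]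
    · simp [cre_apply, ann_apply, hi, wedgeSign_insert_self, smul_smul, wedgeSign_mul_self]
  have hji : j ≠ i := fun h => hij h.symm
  by_cases hi : i ∈ S
  · simp [cre_apply, ann_apply, hi, hij]
  by_cases hj : j ∈ S
  · obtain ⟨T, hjT, rfl⟩ : ∃ T, j ∉ T ∧ S = insert j T :=
      ⟨S.erase j, by simp, (Finset.insert_erase hj).symm⟩
    have hiT : i ∉ T := fun h => hi (by simp [h])
    have h2 : (insert i (insert j T)).erase j = insert i T := by
      rw [Finset.insert_comm]; exact Finset.erase_insert (by simp [hji, hjT])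
    simp only [cre_apply, ann_apply, hi, hij, hiT, Pi.sub_apply, Pi.zero_apply,
      Finset.mem_insert, hji, true_or, or_true, if_true, if_false,
      Finset.erase_insert hjT, h2, smul_smul, zero_sub, ← neg_smul]
    congr 1
    rw [Finset.insert_comm, wedgeSign_insert_self, wedgeSign_insert_self, wedgeSign_insert hjT,
      wedgeSign_insert hiT]
    rcases lt_or_gt_of_ne hij with h | h
    · simp [h, h.not_gt, mul_comm]
    · simp [h, h.not_gt, mul_comm]
  · simp [cre_apply, ann_apply, hi, hj, hij, hji]

/-- Contraction with the covector `c`. -/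
def contract (c : Fin n → ℂ) : (Finset (Fin n) → M) →ₗ[ℂ] (Finset (Fin n) → M) :=
  ∑ i, c i • ann i

/-- Left exterior multiplication by the vector `c`. -/
def wedgeVec (c : Fin n → ℂ) : (Finset (Fin n) → M) →ₗ[ℂ] (Finset (Fin n) → M) :=
  ∑ i, c i • cre i

lemma contract_apply (c : Fin n → ℂ) (u : Finset (Fin n) → M) :
    contract c u = ∑ i, c i • ann i u := by
  simp [contract, LinearMap.sum_apply]

lemma wedgeVec_apply (c : Fin n → ℂ) (u : Finset (Fin n) → M) :
    wedgeVec c u = ∑ i, c i • cre i u := by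
  simp [wedgeVec, LinearMap.sum_apply]

/-- A double sum of an antisymmetric family vanishes. -/
lemma sum_sum_eq_zero_of_antisymm {ι V : Type*} [Fintype ι] [AddCommGroup V] [Module ℂ V]
    (F : ι → ι → V) (h : ∀ i j, F i j = -F j i) : ∑ i, ∑ j, F i j = 0 := by
  have h1 : ∑ i, ∑ j, F i j = -∑ i, ∑ j, F i j := by
    conv_lhs => rw [Finset.sum_comm]
    simp only [← Finset.sum_neg_distrib]
    exact Finset.sum_congr rfl fun i _ => Finset.sum_congr rfl fun j _ => h j i
  have h2 : (2 : ℂ) • ∑ i, ∑ j, F i j = 0 := by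
    rw [two_smul]; nth_rewrite 1 [h1]; exact neg_add_cancel _
  exact (smul_eq_zero.mp h2).resolve_left two_ne_zero

lemma contract_contract (c : Fin n → ℂ) (u : Finset (Fin n) → M) :
    contract c (contract c u) = 0 := by
  simp only [contract_apply, map_sum, map_smul, Finset.smul_sum, smul_smul]
  exact sum_sum_eq_zero_of_antisymm _ fun i j => by rw [ann_ann, smul_neg, mul_comm]

lemma contract_wedgeVec (f c : Fin n → ℂ) (hfc : ∑ i, f i * c i = 1) (u : Finset (Fin n) → M) :
    contract f (wedgeVec c u) = u - wedgeVec c (contract f u) := by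
  have h1 : contract f (wedgeVec c u) + wedgeVec c (contract f u)
      = ∑ i, ∑ j, (f i * c j) • (if i = j then u else 0) := by
    simp only [contract_apply, wedgeVec_apply, map_sum, map_smul, Finset.smul_sum, smul_smul]
    rw [Finset.sum_comm (f := fun i j => (c i * f j) • ann j (cre i u)),
      ← Finset.sum_add_distrib]
    refine Finset.sum_congr rfl fun i _ => ?_
    rw [← Finset.sum_add_distrib]
    refine Finset.sum_congr rfl fun j _ => ?_
    rw [ann_cre, smul_sub, mul_comm (c j), sub_add_cancel]
  rw [eq_sub_iff_add_eq, h1]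
  simp [← Finset.sum_smul, hfc]

end Fermions

/-! ### The fibre of the Koszul complex -/

section Koszul

variable {N d : ℕ}

/-- The fibre of the Koszul complex: the coefficients of forms `∑_K u_K dz̄_K` with values in the
exterior algebra of `ℂ^N`, with the sup norm. -/
abbrev KoszulFibre (N d : ℕ) : Type := Finset (Fin N) → Finset (Fin d) → ℂ

/-- Left exterior multiplication by `dz̄_k`. -/
def creForm (k : Fin d) : KoszulFibre N d →ₗ[ℂ] KoszulFibre N d :=
  LinearMap.compLeft (cre k) (Finset (Fin N))

lemma creForm_apply (k : Fin d) (u : KoszulFibre N d) (S : Finset (Fin N)) :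
    creForm k u S = cre k (u S) := rfl

/-- Exterior multiplication by the vector-valued `(0,1)`-form with coefficients `b`; the signs are
those of a tensor product in which the two sets of generators commute. -/
def wedgeMat (b : Fin N → Fin d → ℂ) : KoszulFibre N d →ₗ[ℂ] KoszulFibre N d :=
  ∑ s, ∑ k, b s k • (cre s ∘ₗ creForm k)

lemma wedgeMat_apply (b : Fin N → Fin d → ℂ) (u : KoszulFibre N d) :
    wedgeMat b u = ∑ s, ∑ k, b s k • cre s (creForm k u) := by
  simp [wedgeMat, LinearMap.sum_apply]

lemma creForm_creForm (k l : Fin d) (u : KoszulFibre N d) :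
    creForm k (creForm l u) = -creForm l (creForm k u) := by
  ext1 S; simp only [creForm_apply, Pi.neg_apply, cre_cre k l]

lemma creForm_cre (k : Fin d) (s : Fin N) (u : KoszulFibre N d) :
    creForm k (cre s u) = cre s (creForm k u) := by
  ext1 S
  by_cases h : s ∈ S <;> simp [creForm_apply, cre_apply, h]

lemma creForm_ann (k : Fin d) (s : Fin N) (u : KoszulFibre N d) :
    creForm k (ann s u) = ann s (creForm k u) := by
  ext1 S
  by_cases h : s ∈ S <;> simp [creForm_apply, ann_apply, h]

lemma contract_wedgeMat (f : Fin N → ℂ) (b : Fin N → Fin d → ℂ)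
    (hfb : ∀ k, ∑ s, f s * b s k = 0) (u : KoszulFibre N d) :
    contract f (wedgeMat b u) = -wedgeMat b (contract f u) := by
  have h1 : contract f (wedgeMat b u) + wedgeMat b (contract f u)
      = ∑ i, ∑ j, ∑ k, (f i * b j k) • (if i = j then creForm k u else 0) := by
    simp only [contract_apply, wedgeMat_apply, map_sum, map_smul, Finset.smul_sum, smul_smul]
    rw [Finset.sum_congr rfl fun s _ => Finset.sum_comm, Finset.sum_comm
      (f := fun s i => ∑ k, (b s k * f i) • ann i (cre s (creForm k u))),
      ← Finset.sum_add_distrib]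
    refine Finset.sum_congr rfl fun i _ => ?_
    rw [← Finset.sum_add_distrib]
    refine Finset.sum_congr rfl fun j _ => ?_
    rw [← Finset.sum_add_distrib]
    refine Finset.sum_congr rfl fun k _ => ?_
    rw [ann_cre, smul_sub, mul_comm (b j k), creForm_ann, sub_add_cancel]
  rw [eq_neg_iff_add_eq_zero, h1]
  simp only [smul_ite, smul_zero]
  rw [Finset.sum_congr rfl fun i _ => Finset.sum_comm, Finset.sum_comm]
  simp [← Finset.sum_smul, hfb]

/-- `u` is homogeneous of form degree `q`. -/
def HasFormDegree (q : ℕ) (u : KoszulFibre N d) : Prop :=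
  ∀ S K, K.card ≠ q → u S K = 0

lemma HasFormDegree.wedgeVec {q : ℕ} {u : KoszulFibre N d} (hu : HasFormDegree q u)
    (c : Fin N → ℂ) : HasFormDegree q (wedgeVec c u) := by
  intro S K hK
  rw [wedgeVec_apply]
  simp only [Finset.sum_apply, Pi.smul_apply, cre_apply]
  refine Finset.sum_eq_zero fun i _ => ?_
  split_ifs <;> simp [hu _ K hK]

lemma HasFormDegree.contract {q : ℕ} {u : KoszulFibre N d} (hu : HasFormDegree q u)
    (c : Fin N → ℂ) : HasFormDegree q (contract c u) := by
  intro S K hK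
  rw [contract_apply]
  simp only [Finset.sum_apply, Pi.smul_apply, ann_apply]
  refine Finset.sum_eq_zero fun i _ => ?_
  split_ifs <;> simp [hu _ K hK]

lemma HasFormDegree.wedgeMat {q : ℕ} {u : KoszulFibre N d} (hu : HasFormDegree q u)
    (b : Fin N → Fin d → ℂ) : HasFormDegree (q + 1) (wedgeMat b u) := by
  intro S K hK
  rw [wedgeMat_apply]
  simp only [Finset.sum_apply, Pi.smul_apply, cre_apply, creForm_apply]
  refine Finset.sum_eq_zero fun s _ => Finset.sum_eq_zero fun k _ => ?_
  split_ifs with h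
  · simp only [Pi.smul_apply, cre_apply]
    split_ifs with hk
    · rw [hu _ (K.erase k)]
      · simp
      · rw [Finset.card_erase_of_mem hk]
        have := Finset.card_pos.mpr ⟨k, hk⟩
        omega
    · simp
  · simp

/-- The element `1` of the exterior algebra. -/
def koszulOne : KoszulFibre N d := Pi.single ∅ (Pi.single ∅ 1)

lemma hasFormDegree_koszulOne : HasFormDegree 0 (koszulOne : KoszulFibre N d) := by
  intro S K hK
  have hK : K ≠ ∅ := fun h => hK (by simp [h])
  by_cases hS : S = ∅
  · subst hS; simp [koszulOne, hK]
  · simp [koszulOne, hS]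

lemma contract_koszulOne (f : Fin N → ℂ) : contract f (koszulOne : KoszulFibre N d) = 0 := by
  rw [contract_apply]
  refine Finset.sum_eq_zero fun s _ => ?_
  have : ann s (koszulOne : KoszulFibre N d) = 0 := by
    ext1 S
    simp [ann_apply, koszulOne]
  rw [this, smul_zero]

lemma norm_koszulOne : ‖(koszulOne : KoszulFibre N d)‖ ≤ 1 := by
  refine (pi_norm_le_iff_of_nonneg zero_le_one).2 fun S => ?_
  refine (pi_norm_le_iff_of_nonneg zero_le_one).2 fun K => ?_
  by_cases hS : S = ∅
  · subst hS
    by_cases hK : K = ∅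
    · subst hK; simp [koszulOne]
    · simp [koszulOne, hK]
  · simp [koszulOne, hS]

lemma norm_cre_le {n : ℕ} {M : Type*} [NormedAddCommGroup M] [NormedSpace ℂ M] (i : Fin n)
    (u : Finset (Fin n) → M) : ‖cre i u‖ ≤ ‖u‖ := by
  refine (pi_norm_le_iff_of_nonneg (norm_nonneg _)).2 fun S => ?_
  rw [cre_apply]
  split_ifs
  · rw [norm_smul, norm_wedgeSign, one_mul]; exact norm_le_pi_norm u _
  · simp

lemma norm_creForm_le (k : Fin d) (u : KoszulFibre N d) : ‖creForm k u‖ ≤ ‖u‖ := by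
  refine (pi_norm_le_iff_of_nonneg (norm_nonneg _)).2 fun S => ?_
  exact (norm_cre_le _ _).trans (norm_le_pi_norm u S)

lemma norm_wedgeVec_le {c : Fin N → ℂ} {A : ℝ} (hc : ∀ s, ‖c s‖ ≤ A) (u : KoszulFibre N d) :
    ‖wedgeVec c u‖ ≤ N * A * ‖u‖ := by
  rw [wedgeVec_apply]
  refine (norm_sum_le _ _).trans ?_
  have : ∀ s ∈ (Finset.univ : Finset (Fin N)), ‖c s • cre s u‖ ≤ A * ‖u‖ := fun s _ => by
    rw [norm_smul]
    exact mul_le_mul (hc s) (norm_cre_le s u) (norm_nonneg _) ((norm_nonneg _).trans (hc s))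
  refine (Finset.sum_le_sum this).trans (le_of_eq ?_)
  simp [mul_assoc]

lemma norm_wedgeMat_le {b : Fin N → Fin d → ℂ} {B : ℝ} (hb : ∀ s k, ‖b s k‖ ≤ B)
    (u : KoszulFibre N d) : ‖wedgeMat b u‖ ≤ N * d * B * ‖u‖ := by
  rw [wedgeMat_apply]
  have : ∀ s k, ‖b s k • cre s (creForm k u)‖ ≤ B * ‖u‖ := fun s k => by
    rw [norm_smul]
    exact mul_le_mul (hb s k) ((norm_cre_le s _).trans (norm_creForm_le k u)) (norm_nonneg _)
      ((norm_nonneg _).trans (hb s k))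
  refine (norm_sum_le _ _).trans ((Finset.sum_le_sum fun s _ => (norm_sum_le _ _).trans
    (Finset.sum_le_sum fun k _ => this s k)).trans (le_of_eq ?_))
  simp [mul_assoc]

end Koszul

/-! ### Wirtinger derivatives -/

section Wirtinger

variable {d : ℕ} {F G : Type*} [NormedAddCommGroup F] [NormedSpace ℂ F]
  [NormedAddCommGroup G] [NormedSpace ℂ G]

/-- The Wirtinger derivative `∂/∂z̄_k` of a vector-valued function. -/
noncomputable def wirtV (k : Fin d) (φ : (Fin d → ℂ) → F) (z : Fin d → ℂ) : F :=
  (1 / 2 : ℂ) • (fderiv ℝ φ z (Pi.single k 1) + Complex.I • fderiv ℝ φ z (Pi.single k Complex.I))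

lemma wirtingerBar_eq_wirtV (k : Fin d) (φ : (Fin d → ℂ) → ℂ) (z : Fin d → ℂ) :
    wirtingerBar k φ z = wirtV k φ z := rfl

lemma wirtV_congr {k : Fin d} {φ ψ : (Fin d → ℂ) → F} {z : Fin d → ℂ}
    (h : φ =ᶠ[nhds z] ψ) : wirtV k φ z = wirtV k ψ z := by
  simp only [wirtV, h.fderiv_eq]

lemma wirtV_const (k : Fin d) (c : F) (z : Fin d → ℂ) : wirtV k (fun _ => c) z = 0 := by
  simp [wirtV]

lemma wirtV_sum {ι : Type*} (s : Finset ι) (k : Fin d) {φ : ι → (Fin d → ℂ) → F}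
    {z : Fin d → ℂ} (h : ∀ i ∈ s, DifferentiableAt ℝ (φ i) z) :
    wirtV k (fun z => ∑ i ∈ s, φ i z) z = ∑ i ∈ s, wirtV k (φ i) z := by
  simp only [wirtV, fderiv_fun_sum h, sum_apply, Finset.smul_sum,
    ← Finset.sum_add_distrib]

lemma wirtV_smul (k : Fin d) {φ : (Fin d → ℂ) → ℂ} {u : (Fin d → ℂ) → F}
    {z : Fin d → ℂ} (hφ : DifferentiableAt ℝ φ z) (hu : DifferentiableAt ℝ u z) :
    wirtV k (fun z => φ z • u z) z = wirtV k φ z • u z + φ z • wirtV k u z := by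
  simp only [wirtV, fderiv_fun_smul hφ hu, add_apply,
    smul_apply, ContinuousLinearMap.smulRight_apply, smul_eq_mul]
  module

lemma wirtV_clm (k : Fin d) (L : F →L[ℂ] G) {u : (Fin d → ℂ) → F} {z : Fin d → ℂ}
    (hu : DifferentiableAt ℝ u z) : wirtV k (fun z => L (u z)) z = L (wirtV k u z) := by
  have : fderiv ℝ (fun z => L (u z)) z = (L.restrictScalars ℝ).comp (fderiv ℝ u z) :=
    ((L.restrictScalars ℝ).hasFDerivAt.comp z hu.hasFDerivAt).fderiv
  simp [wirtV, this]

lemma wirtV_of_holomorphic (k : Fin d) {φ : (Fin d → ℂ) → F} {z : Fin d → ℂ}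
    (hφ : DifferentiableAt ℂ φ z) : wirtV k φ z = 0 := by
  have h : Pi.single k Complex.I = Complex.I • (Pi.single k 1 : Fin d → ℂ) := by
    rw [← Pi.single_smul]; simp
  simp only [wirtV, hφ.fderiv_restrictScalars ℝ, ContinuousLinearMap.coe_restrictScalars', h,
    map_smul, smul_smul]
  simp

lemma wirtV_conj (k : Fin d) {φ : (Fin d → ℂ) → ℂ} {z : Fin d → ℂ}
    (hφ : DifferentiableAt ℂ φ z) :
    wirtV k (fun z => (starRingEnd ℂ) (φ z)) z
      = (starRingEnd ℂ) (fderiv ℂ φ z (Pi.single k 1)) := by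
  have h : Pi.single k Complex.I = Complex.I • (Pi.single k 1 : Fin d → ℂ) := by
    rw [← Pi.single_smul]; simp
  have h1 : fderiv ℝ (fun z => (starRingEnd ℂ) (φ z)) z
      = (Complex.conjCLE : ℂ →L[ℝ] ℂ).comp ((fderiv ℂ φ z).restrictScalars ℝ) := by
    rw [← hφ.fderiv_restrictScalars ℝ]
    exact ((Complex.conjCLE : ℂ →L[ℝ] ℂ).hasFDerivAt.comp z
      (hφ.restrictScalars ℝ).hasFDerivAt).fderiv
  simp only [wirtV, h1, ContinuousLinearMap.coe_comp, Function.comp_apply,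
    ContinuousLinearMap.coe_restrictScalars', h, map_smul]
  simp only [ContinuousLinearEquiv.coe_coe, Complex.conjCLE_apply, smul_eq_mul, map_mul,
    Complex.conj_I]
  linear_combination (-(1 / 2 : ℂ) * (starRingEnd ℂ) (fderiv ℂ φ z (Pi.single k 1)))
    * Complex.I_mul_I

/-- Chain rule for a function of a real variable composed with a real-valued function. -/
lemma wirtV_comp_real (k : Fin d) {η : ℝ → ℝ} {s : (Fin d → ℂ) → ℝ} {z : Fin d → ℂ}
    (hη : DifferentiableAt ℝ η (s z)) (hs : DifferentiableAt ℝ s z) :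
    wirtV k (fun z => (η (s z) : ℂ)) z
      = ((deriv η (s z) : ℝ) : ℂ) * wirtV k (fun z => (s z : ℂ)) z := by
  have h1 : fderiv ℝ (fun z => (s z : ℂ)) z = Complex.ofRealCLM.comp (fderiv ℝ s z) :=
    (Complex.ofRealCLM.hasFDerivAt.comp z hs.hasFDerivAt).fderiv
  have h2 : fderiv ℝ (fun z => (η (s z) : ℂ)) z
      = Complex.ofRealCLM.comp (deriv η (s z) • fderiv ℝ s z) :=
    (Complex.ofRealCLM.hasFDerivAt.comp z
      (hη.hasDerivAt.comp_hasFDerivAt z hs.hasFDerivAt)).fderiv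
  simp [wirtV, h1, h2]
  ring

/-- A real-differentiable function whose Wirtinger derivatives vanish at `z` is complex
differentiable at `z`. -/
lemma differentiableAt_of_wirtV_eq_zero {φ : (Fin d → ℂ) → ℂ} {z : Fin d → ℂ}
    (hφ : DifferentiableAt ℝ φ z) (h : ∀ k, wirtV k φ z = 0) : DifferentiableAt ℂ φ z := by
  rw [differentiableAt_iff_restrictScalars ℝ hφ]
  set A := fderiv ℝ φ z
  have hI : ∀ k, A (Pi.single k Complex.I) = Complex.I * A (Pi.single k 1) := fun k => by
    have := h k
    simp only [wirtV, smul_eq_mul] at this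
    have h3 : A (Pi.single k 1) + Complex.I * A (Pi.single k Complex.I) = 0 := by
      simpa using this
    linear_combination (-Complex.I) * h3 + A (Pi.single k Complex.I) * Complex.I_mul_I
  have hA : ∀ v : Fin d → ℂ, A v = ∑ k, v k * A (Pi.single k 1) := fun v => by
    have hv : v = ∑ k, ((v k).re • (Pi.single k 1 : Fin d → ℂ)
        + (v k).im • (Pi.single k Complex.I : Fin d → ℂ)) := by
      ext j
      simp [Finset.sum_add_distrib, Pi.single_apply, Complex.re_add_im]
    conv_lhs => rw [hv]
    simp only [map_sum, map_add, map_smul, hI]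
    refine Finset.sum_congr rfl fun k _ => ?_
    conv_rhs => rw [← Complex.re_add_im (v k)]
    simp only [Complex.real_smul]
    ring
  refine ⟨∑ k, (A (Pi.single k 1)) • (ContinuousLinearMap.proj k : (Fin d → ℂ) →L[ℂ] ℂ), ?_⟩
  ext v
  simp [hA v, mul_comm]

lemma contDiffOn_wirtV {Ω : Set (Fin d → ℂ)} (hΩ : IsOpen Ω) (k : Fin d)
    {u : (Fin d → ℂ) → F} (hu : ContDiffOn ℝ (⊤ : ℕ∞) u Ω) :
    ContDiffOn ℝ (⊤ : ℕ∞) (wirtV k u) Ω := by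
  have h : ContDiffOn ℝ (⊤ : ℕ∞) (fderiv ℝ u) Ω := hu.fderiv_of_isOpen hΩ (by simp)
  have h1 := h.clm_apply (contDiffOn_const (c := (Pi.single k 1 : Fin d → ℂ)))
  have h2 := h.clm_apply (contDiffOn_const (c := (Pi.single k Complex.I : Fin d → ℂ)))
  unfold wirtV
  exact contDiffOn_const.smul (h1.add (contDiffOn_const.smul h2))

/-- Mixed Wirtinger derivatives commute. -/
lemma wirtV_comm {u : (Fin d → ℂ) → F} {z : Fin d → ℂ} (k l : Fin d)
    (hu : ContDiffAt ℝ (⊤ : ℕ∞) u z) : wirtV k (wirtV l u) z = wirtV l (wirtV k u) z := by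
  have hd : DifferentiableAt ℝ (fderiv ℝ u) z :=
    (hu.fderiv_right (m := 1) (by norm_cast)).differentiableAt (by norm_num)
  have hsymm : IsSymmSndFDerivAt ℝ u z := hu.isSymmSndFDerivAt (by simp; norm_cast)
  have key : ∀ (l : Fin d) (v : Fin d → ℂ), fderiv ℝ (wirtV l u) z v
      = (1 / 2 : ℂ) • (fderiv ℝ (fderiv ℝ u) z v (Pi.single l 1)
        + Complex.I • fderiv ℝ (fderiv ℝ u) z v (Pi.single l Complex.I)) := fun l v => by
    have h1 : ∀ w : Fin d → ℂ, HasFDerivAt (fun y => fderiv ℝ u y w)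
        ((ContinuousLinearMap.apply ℝ F w).comp (fderiv ℝ (fderiv ℝ u) z)) z := fun w =>
      (ContinuousLinearMap.apply ℝ F w).hasFDerivAt.comp z hd.hasFDerivAt
    have h2 := ((h1 (Pi.single l 1)).add
      ((h1 (Pi.single l Complex.I)).const_smul Complex.I)).const_smul (1 / 2 : ℂ)
    have h3 : fderiv ℝ (wirtV l u) z = _ := h2.fderiv
    rw [h3]; simp
  simp only [wirtV] at key ⊢
  simp only [key]
  rw [hsymm.eq (Pi.single k 1) (Pi.single l 1), hsymm.eq (Pi.single k 1) (Pi.single l Complex.I),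
    hsymm.eq (Pi.single k Complex.I) (Pi.single l 1),
    hsymm.eq (Pi.single k Complex.I) (Pi.single l Complex.I)]
  module

end Wirtinger

/-! ### The weak `∂̄` operator -/

section Weak

variable {d : ℕ} {Ω : Set (Fin d → ℂ)}

/-- The product of a function smooth on the open set `Ω` and a test function supported in `Ω` is
smooth on the whole space. -/
lemma contDiff_mul_test (hΩ : IsOpen Ω) {v φ : (Fin d → ℂ) → ℂ}
    (hv : ContDiffOn ℝ (⊤ : ℕ∞) v Ω) (hφ : ContDiff ℝ (⊤ : ℕ∞) φ) (hs : tsupport φ ⊆ Ω) :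
    ContDiff ℝ (⊤ : ℕ∞) (fun z => v z * φ z) := by
  rw [contDiff_iff_contDiffAt]
  intro z
  by_cases hz : z ∈ tsupport φ
  · exact (hv.contDiffAt (hΩ.mem_nhds (hs hz))).mul hφ.contDiffAt
  · have : (fun z => v z * φ z) =ᶠ[nhds z] fun _ => 0 := by
      filter_upwards [notMem_tsupport_iff_eventuallyEq.mp hz] with y hy
      simp [hy]
    exact contDiffAt_const.congr_of_eventuallyEq this

lemma tsupport_mul_test (v φ : (Fin d → ℂ) → ℂ) : tsupport (fun z => v z * φ z) ⊆ tsupport φ :=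
  closure_mono (Function.support_mul_subset_right v φ)

lemma support_wirtV_subset (k : Fin d) (φ : (Fin d → ℂ) → ℂ) :
    Function.support (wirtV k φ) ⊆ tsupport φ := by
  intro z hz
  by_contra h
  refine hz ?_
  rw [wirtV_congr (notMem_tsupport_iff_eventuallyEq.mp h)]
  exact wirtV_const k 0 z

lemma contDiff_wirtV (k : Fin d) {φ : (Fin d → ℂ) → ℂ} (hφ : ContDiff ℝ (⊤ : ℕ∞) φ) :
    ContDiff ℝ (⊤ : ℕ∞) (wirtV k φ) :=
  contDiffOn_univ.mp (contDiffOn_wirtV isOpen_univ k hφ.contDiffOn)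

lemma hasCompactSupport_wirtV (k : Fin d) {φ : (Fin d → ℂ) → ℂ} (hφ : HasCompactSupport φ) :
    HasCompactSupport (wirtV k φ) :=
  hφ.mono' (support_wirtV_subset k φ)

lemma integral_fderiv_eq_zero {φ : (Fin d → ℂ) → ℂ} (hφ : ContDiff ℝ (⊤ : ℕ∞) φ)
    (hc : HasCompactSupport φ) (v : Fin d → ℂ) : ∫ z, fderiv ℝ φ z v = 0 := by
  have hd : Differentiable ℝ φ := hφ.differentiable (by simp)
  have hcont : Continuous (fun z => fderiv ℝ φ z v) :=
    (hφ.continuous_fderiv (by simp)).clm_apply continuous_const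
  have hcs : HasCompactSupport (fun z => fderiv ℝ φ z v) := hc.fderiv_apply (𝕜 := ℝ) v
  have h := integral_smul_fderiv_eq_neg_fderiv_smul_of_integrable (μ := volume) (𝕜 := ℝ)
    (f := fun _ : Fin d → ℂ => (1 : ℝ)) (g := φ) (v := v)
    (by simp) (by simpa using hcont.integrable_of_hasCompactSupport hcs)
    (by simpa using hφ.continuous.integrable_of_hasCompactSupport hc)
    (by simp) (fun x _ => hd x)
  simpa using h

lemma integral_wirtV_eq_zero {φ : (Fin d → ℂ) → ℂ} (hφ : ContDiff ℝ (⊤ : ℕ∞) φ)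
    (hc : HasCompactSupport φ) (k : Fin d) : ∫ z, wirtV k φ z = 0 := by
  have hi : ∀ v, Integrable (fun z => fderiv ℝ φ z v) := fun v =>
    ((hφ.continuous_fderiv (by simp)).clm_apply
      continuous_const).integrable_of_hasCompactSupport (hc.fderiv_apply (𝕜 := ℝ) v)
  simp only [wirtV, smul_eq_mul]
  rw [integral_const_mul, integral_add (hi _) ((hi _).const_mul _), integral_const_mul,
    integral_fderiv_eq_zero hφ hc, integral_fderiv_eq_zero hφ hc]
  simp

/-- Integration by parts for `∂/∂z̄_k` against a test function. -/
lemma integral_mul_wirtV (hΩ : IsOpen Ω) {v φ : (Fin d → ℂ) → ℂ}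
    (hv : ContDiffOn ℝ (⊤ : ℕ∞) v Ω) (hφ : ContDiff ℝ (⊤ : ℕ∞) φ) (hc : HasCompactSupport φ)
    (hs : tsupport φ ⊆ Ω) (k : Fin d) :
    ∫ z in Ω, v z * wirtV k φ z = -∫ z in Ω, wirtV k v z * φ z := by
  have hvφ := contDiff_mul_test hΩ hv hφ hs
  have hsw : tsupport (wirtV k φ) ⊆ Ω :=
    (closure_minimal (support_wirtV_subset k φ) (isClosed_tsupport φ)).trans hs
  have h1 := contDiff_mul_test hΩ hv (contDiff_wirtV k hφ) hsw
  have h2 := contDiff_mul_test hΩ (contDiffOn_wirtV hΩ k hv) hφ hs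
  have e1 : ∫ z in Ω, v z * wirtV k φ z = ∫ z, v z * wirtV k φ z :=
    setIntegral_eq_integral_of_forall_compl_eq_zero fun z hz => by
      rw [Function.notMem_support.mp fun h => hz (hs (support_wirtV_subset k φ h)), mul_zero]
  have e2 : ∫ z in Ω, wirtV k v z * φ z = ∫ z, wirtV k v z * φ z :=
    setIntegral_eq_integral_of_forall_compl_eq_zero fun z hz => by
      rw [image_eq_zero_of_notMem_tsupport fun h => hz (hs h), mul_zero]
  have e3 : ∀ z, wirtV k (fun z => v z * φ z) z = v z * wirtV k φ z + wirtV k v z * φ z := by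
    intro z
    by_cases hz : z ∈ Ω
    · have := wirtV_smul k ((hv.contDiffAt (hΩ.mem_nhds hz)).differentiableAt (by simp))
        (hφ.differentiable (by simp) z)
      simp only [smul_eq_mul] at this
      rw [this]; ring
    · have hz' : z ∉ tsupport φ := fun h => hz (hs h)
      rw [Function.notMem_support.mp fun h => hz' (support_wirtV_subset k φ h),
        image_eq_zero_of_notMem_tsupport hz', Function.notMem_support.mp fun h =>
        hz' (tsupport_mul_test v φ (support_wirtV_subset k _ h))]
      simp
  have h3 := integral_wirtV_eq_zero hvφ (hc.mul_left) k
  rw [integral_congr_ae (Filter.Eventually.of_forall e3), integral_add] at h3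
  · rw [e1, e2]; exact eq_neg_of_add_eq_zero_left h3
  · exact h1.continuous.integrable_of_hasCompactSupport (hasCompactSupport_wirtV k hc).mul_left
  · exact h2.continuous.integrable_of_hasCompactSupport hc.mul_left

/-- A form with smooth coefficients has its classical `∂̄` as weak `∂̄`. -/
lemma weakDbar_of_contDiffOn (hΩ : IsOpen Ω) {u ω : BarForm d}
    (hu : ∀ K, ContDiffOn ℝ (⊤ : ℕ∞) (u K) Ω)
    (hω : ∀ K, ∀ z ∈ Ω, ω K z = ∑ k ∈ K, wedgeSign k K * wirtV k (u (K.erase k)) z) :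
    WeakDbar Ω u ω := by
  intro K φ hφ hc hs
  simp only [wirtingerBar_eq_wirtV]
  have hi : ∀ k ∈ K, Integrable (fun z => wedgeSign k K * (wirtV k (u (K.erase k)) z * φ z))
      (volume.restrict Ω) := fun k _ =>
    (((contDiff_mul_test hΩ (contDiffOn_wirtV hΩ k (hu _)) hφ
      hs).continuous.integrable_of_hasCompactSupport hc.mul_left).const_mul _).restrict
  have e : ∫ z in Ω, ω K z * φ z
      = ∑ k ∈ K, wedgeSign k K * ∫ z in Ω, wirtV k (u (K.erase k)) z * φ z := by
    simp only [← integral_const_mul]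
    rw [← integral_finsetSum _ hi]
    refine setIntegral_congr_fun hΩ.measurableSet fun z hz => ?_
    simp only [hω K z hz, Finset.sum_mul, mul_assoc]
  rw [e, ← Finset.sum_neg_distrib]
  refine Finset.sum_congr rfl fun k _ => ?_
  rw [integral_mul_wirtV hΩ (hu _) hφ hc hs, mul_neg]

/-- Multiplication by a holomorphic function commutes with the weak `∂̄`. -/
lemma WeakDbar.mul_holomorphic (hΩ : IsOpen Ω) {u ω : BarForm d} (h : WeakDbar Ω u ω)
    {f : (Fin d → ℂ) → ℂ} (hf : DifferentiableOn ℂ f Ω) (hf' : ContDiffOn ℝ (⊤ : ℕ∞) f Ω) :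
    WeakDbar Ω (fun K z => f z * u K z) (fun K z => f z * ω K z) := by
  intro K φ hφ hc hs
  have h1 := h K (fun z => f z * φ z) (contDiff_mul_test hΩ hf' hφ hs) hc.mul_left
    ((tsupport_mul_test f φ).trans hs)
  simp only [wirtingerBar_eq_wirtV] at h1 ⊢
  have e1 : ∀ k, ∫ z in Ω, u (K.erase k) z * wirtV k (fun z => f z * φ z) z
      = ∫ z in Ω, f z * u (K.erase k) z * wirtV k φ z := fun k => by
    refine setIntegral_congr_fun hΩ.measurableSet fun z hz => ?_
    have hd := hf.differentiableAt (hΩ.mem_nhds hz)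
    have := wirtV_smul k (hd.restrictScalars ℝ) (hφ.differentiable (by simp) z)
    simp only [smul_eq_mul, wirtV_of_holomorphic k hd, zero_mul, zero_add] at this
    simp only [this]; ring
  have e2 : ∫ z in Ω, ω K z * (f z * φ z) = ∫ z in Ω, f z * ω K z * φ z := by
    congr 1; ext z; ring
  simp only [e1, e2] at h1
  exact h1

lemma MemLp.integrable_mul_test {v φ : (Fin d → ℂ) → ℂ} (hv : MemLp v ∞ (volume.restrict Ω))
    (hφ : Continuous φ) (hc : HasCompactSupport φ) :
    Integrable (fun z => v z * φ z) (volume.restrict Ω) := by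
  have h1 : Integrable φ (volume.restrict Ω) := (hφ.integrable_of_hasCompactSupport hc).restrict
  exact h1.mul_of_top_right hv

lemma integrable_mul_wirtV {v φ : (Fin d → ℂ) → ℂ} (hv : MemLp v ∞ (volume.restrict Ω))
    (hφ : ContDiff ℝ (⊤ : ℕ∞) φ) (hc : HasCompactSupport φ) (k : Fin d) :
    Integrable (fun z => v z * wirtV k φ z) (volume.restrict Ω) :=
  MemLp.integrable_mul_test hv (contDiff_wirtV k hφ).continuous (hasCompactSupport_wirtV k hc)

lemma WeakDbar.add {u u' ω ω' : BarForm d} (h : WeakDbar Ω u ω) (h' : WeakDbar Ω u' ω')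
    (hu : ∀ K, MemLp (u K) ∞ (volume.restrict Ω)) (hu' : ∀ K, MemLp (u' K) ∞ (volume.restrict Ω))
    (hω : ∀ K, MemLp (ω K) ∞ (volume.restrict Ω))
    (hω' : ∀ K, MemLp (ω' K) ∞ (volume.restrict Ω)) :
    WeakDbar Ω (u + u') (ω + ω') := by
  intro K φ hφ hc hs
  have h1 := h K φ hφ hc hs
  have h2 := h' K φ hφ hc hs
  simp only [wirtingerBar_eq_wirtV, Pi.add_apply, add_mul] at h1 h2 ⊢
  rw [integral_add (MemLp.integrable_mul_test (hω K) hφ.continuous hc)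
    (MemLp.integrable_mul_test (hω' K) hφ.continuous hc), neg_add, ← h1, ← h2,
    ← Finset.sum_add_distrib]
  refine Finset.sum_congr rfl fun k _ => ?_
  rw [integral_add (integrable_mul_wirtV (hu _) hφ hc k) (integrable_mul_wirtV (hu' _) hφ hc k),
    mul_add]

lemma weakDbar_zero : WeakDbar Ω 0 0 := by
  intro K φ hφ hc hs
  simp

lemma WeakDbar.sum {ι : Type*} (s : Finset ι) {u ω : ι → BarForm d}
    (h : ∀ i ∈ s, WeakDbar Ω (u i) (ω i))
    (hu : ∀ i ∈ s, ∀ K, MemLp (u i K) ∞ (volume.restrict Ω))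
    (hω : ∀ i ∈ s, ∀ K, MemLp (ω i K) ∞ (volume.restrict Ω)) :
    WeakDbar Ω (∑ i ∈ s, u i) (∑ i ∈ s, ω i) := by
  classical
  induction s using Finset.induction_on with
  | empty => simpa using weakDbar_zero
  | insert i s hi ih =>
    rw [Finset.sum_insert hi, Finset.sum_insert hi]
    have hs : ∀ j ∈ s, j ∈ insert i s := fun j hj => Finset.mem_insert_of_mem hj
    refine (h i (Finset.mem_insert_self i s)).add (ih (fun j hj => h j (hs j hj))
      (fun j hj => hu j (hs j hj)) (fun j hj => hω j (hs j hj)))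
      (hu i (Finset.mem_insert_self i s)) (fun K => ?_)
      (hω i (Finset.mem_insert_self i s)) (fun K => ?_)
    · rw [Finset.sum_apply]
      exact memLp_finsetSum' s fun j hj => hu j (hs j hj) K
    · rw [Finset.sum_apply]
      exact memLp_finsetSum' s fun j hj => hω j (hs j hj) K

lemma WeakDbar.congr_ae {u ω ω' : BarForm d} (h : WeakDbar Ω u ω)
    (hω : ∀ K, ω K =ᵐ[volume.restrict Ω] ω' K) : WeakDbar Ω u ω' := by
  intro K φ hφ hc hs
  rw [h K φ hφ hc hs]
  congr 1
  refine integral_congr_ae ?_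
  filter_upwards [hω K] with z hz
  rw [hz]

end Weak

/-! ### Weyl's lemma for `∂̄` -/

section Weyl

open Metric Convolution

variable {d : ℕ}

/-- The convolution of `v` with the kernel `κ`. -/
noncomputable def mollify (κ v : (Fin d → ℂ) → ℂ) (z : Fin d → ℂ) : ℂ := ∫ t, v t * κ (z - t)

lemma mollify_eq_convolution (κ v : (Fin d → ℂ) → ℂ) :
    mollify κ v = v ⋆[ContinuousLinearMap.mul ℝ ℂ, volume] κ := rfl

lemma mollify_eq_integral_sub (κ v : (Fin d → ℂ) → ℂ) (z : Fin d → ℂ) :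
    mollify κ v z = ∫ w, v (z - w) * κ w := by
  rw [mollify_eq_convolution, convolution_eq_swap]; rfl

lemma contDiff_mollify {κ v : (Fin d → ℂ) → ℂ} (hκ : ContDiff ℝ (⊤ : ℕ∞) κ)
    (hc : HasCompactSupport κ) (hv : LocallyIntegrable v) :
    ContDiff ℝ (⊤ : ℕ∞) (mollify κ v) :=
  hc.contDiff_convolution_right (ContinuousLinearMap.mul ℝ ℂ) hv hκ

lemma integrable_mul_comp_sub {κ v : (Fin d → ℂ) → ℂ} (hκ : Continuous κ)
    (hc : HasCompactSupport κ) (hv : LocallyIntegrable v) (z : Fin d → ℂ) :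
    Integrable (fun t => v t * κ (z - t)) :=
  hc.convolutionExists_right (ContinuousLinearMap.mul ℝ ℂ) hv hκ z

lemma wirtV_mollify {κ v : (Fin d → ℂ) → ℂ} (hκ : ContDiff ℝ (⊤ : ℕ∞) κ)
    (hc : HasCompactSupport κ) (hv : LocallyIntegrable v) (k : Fin d) (z : Fin d → ℂ) :
    wirtV k (mollify κ v) z = mollify (wirtV k κ) v z := by
  have hκ1 : ContDiff ℝ 1 κ := hκ.of_le (by norm_cast)
  have h1 : ∀ w, fderiv ℝ (mollify κ v) z w = mollify (fun y => fderiv ℝ κ y w) v z := fun w => by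
    rw [mollify_eq_convolution, mollify_eq_convolution,
      (hc.hasFDerivAt_convolution_right _ hv hκ1 z).fderiv,
      convolution_precompR_apply _ hv (hc.fderiv ℝ) (hκ1.continuous_fderiv one_ne_zero)]
  have hi : ∀ w, Integrable (fun t => v t * fderiv ℝ κ (z - t) w) := fun w =>
    integrable_mul_comp_sub (κ := fun y => fderiv ℝ κ y w)
      ((hκ1.continuous_fderiv one_ne_zero).clm_apply continuous_const)
      (hc.fderiv_apply (𝕜 := ℝ) w) hv z
  simp only [wirtV, h1, mollify, smul_eq_mul]
  rw [← integral_const_mul, ← integral_add (hi _) ((hi _).const_mul _), ← integral_const_mul]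
  congr 1; ext t; ring

/-- Mollifications of a weakly holomorphic function are holomorphic. -/
lemma differentiableAt_mollify {Ω : Set (Fin d → ℂ)} {κ v : (Fin d → ℂ) → ℂ}
    (hκ : ContDiff ℝ (⊤ : ℕ∞) κ) (hc : HasCompactSupport κ) (hv : LocallyIntegrable v) {ε : ℝ}
    (hs : tsupport κ ⊆ closedBall 0 ε)
    (hw : ∀ k (φ : (Fin d → ℂ) → ℂ), ContDiff ℝ (⊤ : ℕ∞) φ → HasCompactSupport φ →
      tsupport φ ⊆ Ω → ∫ z, v z * wirtV k φ z = 0)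
    {z : Fin d → ℂ} (hz : closedBall z ε ⊆ Ω) : DifferentiableAt ℂ (mollify κ v) z := by
  refine differentiableAt_of_wirtV_eq_zero
    ((contDiff_mollify hκ hc hv).differentiable (by simp) z) fun k => ?_
  rw [wirtV_mollify hκ hc hv]
  have hφ : ContDiff ℝ (⊤ : ℕ∞) fun t => κ (z - t) := hκ.comp (contDiff_const.sub contDiff_id)
  have hφs : tsupport (fun t => κ (z - t)) ⊆ closedBall z ε := by
    have h1 : tsupport (fun t => κ (z - t)) ⊆ (fun t => z - t) ⁻¹' tsupport κ :=
      tsupport_comp_subset_preimage κ (by fun_prop)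
    intro t ht
    have := hs (h1 ht)
    rw [mem_closedBall, dist_eq_norm, norm_sub_rev]
    simpa using this
  have hφc : HasCompactSupport (fun t => κ (z - t)) :=
    (isCompact_closedBall z ε).of_isClosed_subset (isClosed_tsupport _) hφs
  have h := hw k _ hφ hφc (hφs.trans hz)
  have h2 : ∀ t, wirtV k (fun t => κ (z - t)) t = -wirtV k κ (z - t) := fun t => by
    have : fderiv ℝ (fun t => κ (z - t)) t = -fderiv ℝ κ (z - t) := by
      have h3 : HasFDerivAt (fun t => z - t) (-ContinuousLinearMap.id ℝ (Fin d → ℂ)) t :=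
        (hasFDerivAt_id t).const_sub z
      have h4 := ((hκ.differentiable (by simp) (z - t)).hasFDerivAt.comp t h3).fderiv
      rw [Function.comp_def] at h4
      rw [h4]
      ext w
      simp
    simp only [wirtV, this, neg_apply]
    module
  simp only [h2, mul_neg, integral_neg, neg_eq_zero] at h
  exact h

lemma norm_mollify_le {κ v : (Fin d → ℂ) → ℂ} (hκ : Integrable κ) {B : ℝ}
    (hB : ∀ᵐ t, ‖v t‖ ≤ B) (z : Fin d → ℂ) : ‖mollify κ v z‖ ≤ B * ∫ t, ‖κ t‖ := by
  rw [mollify, ← integral_sub_left_eq_self (fun t => ‖κ t‖) volume z, ← integral_const_mul]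
  refine norm_integral_le_of_norm_le (((hκ.comp_sub_left z).norm).const_mul B) ?_
  filter_upwards [hB] with t ht
  rw [norm_mul]
  exact mul_le_mul_of_nonneg_right ht (norm_nonneg _)

/-- Multiplication by a unimodular constant preserves the volume of `ℂ^d`. -/
lemma measurePreserving_circle_smul (a : Circle) :
    MeasurePreserving (fun w : Fin d → ℂ => (a : ℂ) • w) := by
  have h := volume_preserving_pi (ι := Fin d) (f := fun _ => rotation a)
    fun _ => (rotation a).measurePreserving
  exact h

/-- The mean value property with respect to a kernel invariant under the circle action. -/
lemma mollify_eq_of_differentiableOn {κ h : (Fin d → ℂ) → ℂ} (hκ : Continuous κ)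
    (hc : HasCompactSupport κ) (hinv : ∀ (a : Circle) w, κ ((a : ℂ) • w) = κ w)
    (hint : ∫ w, κ w = 1) {r R : ℝ} (hrR : r < R) (hs : tsupport κ ⊆ closedBall 0 r)
    (hh : Continuous h) {B : ℝ} (hB : ∀ z, ‖h z‖ ≤ B) {z : Fin d → ℂ}
    (hd : DifferentiableOn ℂ h (ball z R)) : mollify κ h z = h z := by
  rw [mollify_eq_integral_sub]
  have hrot : ∀ θ : ℝ, ∫ w, h (z - circleMap 0 1 θ • w) * κ w = ∫ w, h (z - w) * κ w := by
    intro θ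
    have hθ : circleMap 0 1 θ = (Circle.exp θ : ℂ) := by simp [circleMap]
    rw [← (measurePreserving_circle_smul (d := d) (Circle.exp θ)).integral_comp'
      (f := (Homeomorph.smul (Circle.exp θ)).toMeasurableEquiv)
      (fun w => h (z - w) * κ w)]
    refine integral_congr_ae (Filter.Eventually.of_forall fun w => ?_)
    have : (Homeomorph.smul (Circle.exp θ)).toMeasurableEquiv w
        = ((Circle.exp θ : Circle) : ℂ) • w := rfl
    simp only [this, hinv, hθ]
  have havg : ∀ w, (∫ θ in (0 : ℝ)..2 * Real.pi, h (z - circleMap 0 1 θ • w) * κ w)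
      = (2 * Real.pi : ℝ) * (h z * κ w) := by
    intro w
    rw [intervalIntegral.integral_mul_const]
    by_cases hw : w ∈ tsupport κ
    · have hw' : ‖w‖ ≤ r := by simpa using hs hw
      have hmem : ∀ τ ∈ closedBall (0 : ℂ) 1, z - τ • w ∈ ball z R := fun τ hτ => by
        rw [mem_ball, dist_eq_norm, sub_sub_cancel_left, norm_neg, norm_smul]
        have : ‖τ‖ ≤ 1 := by simpa using hτ
        nlinarith [norm_nonneg τ, norm_nonneg w]
      have hdiff : DifferentiableOn ℂ (fun τ : ℂ => h (z - τ • w)) (closedBall 0 1) :=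
        hd.comp (by fun_prop) hmem
      have hdc : DiffContOnCl ℂ (fun τ : ℂ => h (z - τ • w)) (ball 0 |1|) := by
        rw [abs_one]
        exact ⟨hdiff.mono ball_subset_closedBall,
          hdiff.continuousOn.mono closure_ball_subset_closedBall⟩
      have h1 := hdc.circleAverage
      rw [Real.circleAverage] at h1
      simp only [zero_smul, sub_zero] at h1
      rw [inv_smul_eq_iff₀ (by positivity)] at h1
      rw [h1, Complex.real_smul]; ring
    · rw [image_eq_zero_of_notMem_tsupport hw]; simp
  have : IsFiniteMeasure (volume.restrict (Set.uIoc 0 (2 * Real.pi))) := by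
    rw [Set.uIoc_of_le (by positivity)]; infer_instance
  have hfub : Integrable (Function.uncurry fun (θ : ℝ) (w : Fin d → ℂ) =>
      h (z - circleMap 0 1 θ • w) * κ w)
      ((volume.restrict (Set.uIoc 0 (2 * Real.pi))).prod volume) := by
    have hκi : Integrable (fun p : ℝ × (Fin d → ℂ) => κ p.2)
        ((volume.restrict (Set.uIoc 0 (2 * Real.pi))).prod volume) :=
      (hκ.integrable_of_hasCompactSupport hc).comp_snd _
    refine hκi.bdd_mul (c := B) ?_ (Filter.Eventually.of_forall fun p => hB _)
    have : Continuous fun p : ℝ × (Fin d → ℂ) => h (z - circleMap 0 1 p.1 • p.2) :=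
      hh.comp (continuous_const.sub
        (((continuous_circleMap 0 1).comp continuous_fst).smul continuous_snd))
    exact this.aestronglyMeasurable
  have hswap := intervalIntegral_integral_swap hfub
  simp only [hrot, havg] at hswap
  rw [intervalIntegral.integral_const, integral_const_mul, integral_const_mul, hint] at hswap
  have h2 : ((2 * Real.pi : ℝ) : ℂ) ≠ 0 := by
    exact_mod_cast (by positivity : (2 * Real.pi : ℝ) ≠ 0)
  rw [sub_zero, Complex.real_smul, mul_one] at hswap
  exact mul_left_cancel₀ h2 hswap

/-- There are smooth kernels with integral one and small support that are invariant under the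
circle action. -/
lemma exists_invariant_kernel {r : ℝ} (hr : 0 < r) : ∃ κ : (Fin d → ℂ) → ℂ,
    ContDiff ℝ (⊤ : ℕ∞) κ ∧ tsupport κ ⊆ closedBall 0 r ∧
      (∀ (a : Circle) w, κ ((a : ℂ) • w) = κ w) ∧ ∫ w, κ w = 1 := by
  let ψ : (Fin d → ℂ) → ℝ := fun w => Real.smoothTransition (1 - (∑ i, ‖w i‖ ^ 2) / r ^ 2)
  have hψ : ContDiff ℝ (⊤ : ℕ∞) ψ := by
    refine Real.smoothTransition.contDiff.comp (contDiff_const.sub (ContDiff.div_const ?_ _))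
    exact ContDiff.sum fun i _ => (contDiff_apply ℝ ℂ i).norm_sq ℝ
  have hs : tsupport ψ ⊆ closedBall 0 r := by
    refine closure_minimal (fun w hw => ?_) isClosed_closedBall
    rw [mem_closedBall, dist_zero_right, pi_norm_le_iff_of_nonneg hr.le]
    by_contra! hcon
    obtain ⟨i, hi⟩ := hcon
    refine hw (Real.smoothTransition.zero_of_nonpos ?_)
    have h1 : ‖w i‖ ^ 2 ≤ ∑ i, ‖w i‖ ^ 2 :=
      Finset.single_le_sum (f := fun i => ‖w i‖ ^ 2) (fun i _ => by positivity)
        (Finset.mem_univ i)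
    have h2 : r ^ 2 ≤ ‖w i‖ ^ 2 := by gcongr
    rw [sub_nonpos, one_le_div (by positivity)]
    exact h2.trans h1
  have hcs : HasCompactSupport ψ :=
    (isCompact_closedBall 0 r).of_isClosed_subset (isClosed_tsupport _) hs
  have hpos : 0 < ∫ w, ψ w := by
    refine hψ.continuous.integral_pos_of_hasCompactSupport_nonneg_nonzero hcs
      (fun w => Real.smoothTransition.nonneg _) (x := 0) ?_
    simp [ψ]
  refine ⟨fun w => ((ψ w / ∫ w, ψ w : ℝ) : ℂ), ?_, ?_, ?_, ?_⟩
  · exact Complex.ofRealCLM.contDiff.comp (hψ.div_const _)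
  · refine (closure_mono fun w hw => ?_).trans hs
    intro h0
    exact hw (by simp [h0])
  · intro a w
    simp only [ψ, Pi.smul_apply, smul_eq_mul, norm_mul, Circle.norm_coe, one_mul]
  · rw [integral_complex_ofReal, integral_div, div_self hpos.ne', Complex.ofReal_one]

/-- Local form: near each point a bounded weakly holomorphic function coincides a.e. with one of
its mollifications. -/
lemma exists_local_holomorphic {Ω : Set (Fin d → ℂ)} {v : (Fin d → ℂ) → ℂ}
    (hv : LocallyIntegrable v) {B : ℝ} (hB : ∀ᵐ t, ‖v t‖ ≤ B)
    (hw : ∀ k (φ : (Fin d → ℂ) → ℂ), ContDiff ℝ (⊤ : ℕ∞) φ → HasCompactSupport φ →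
      tsupport φ ⊆ Ω → ∫ z, v z * wirtV k φ z = 0)
    {z₀ : Fin d → ℂ} {r : ℝ} (hr : 0 < r) (hz₀ : ball z₀ (4 * r) ⊆ Ω) :
    ∃ g : (Fin d → ℂ) → ℂ, DifferentiableOn ℂ g (ball z₀ r) ∧
      ∀ᵐ z, z ∈ ball z₀ r → g z = v z := by
  obtain ⟨κ, hκ, hκs, hinv, hint⟩ := exists_invariant_kernel (d := d) hr
  have hκc : HasCompactSupport κ :=
    (isCompact_closedBall 0 r).of_isClosed_subset (isClosed_tsupport _) hκs
  refine ⟨mollify κ v, fun z hz => ?_, ?_⟩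
  · refine (differentiableAt_mollify hκ hκc hv hκs hw
      ((closedBall_subset_ball' ?_).trans hz₀)).differentiableWithinAt
    rw [mem_ball] at hz; linarith
  -- a sequence of bump functions shrinking to the origin, inside the ball of radius `r`
  let φ : ℕ → ContDiffBump (0 : Fin d → ℂ) := fun n =>
    ⟨r / (n + 1) / 2, r / (n + 1), by positivity, half_lt_self (by positivity)⟩
  have hφ0 : Filter.Tendsto (fun n => (φ n).rOut) Filter.atTop (nhds 0) :=
    tendsto_const_div_atTop_nhds_zero_nat r |>.comp (Filter.tendsto_add_atTop_nat 1) |>.congr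
      fun n => by simp [φ]
  have hφr : ∀ n, (φ n).rOut ≤ r := fun n => by
    change r / (n + 1) ≤ r
    exact div_le_self hr.le (by linarith [n.cast_nonneg (α := ℝ)])
  let K : ℕ → (Fin d → ℂ) → ℂ := fun n w => (((φ n).normed volume w : ℝ) : ℂ)
  have hK : ∀ n, ContDiff ℝ (⊤ : ℕ∞) (K n) := fun n =>
    Complex.ofRealCLM.contDiff.comp (φ n).contDiff_normed
  have hKs : ∀ n, tsupport (K n) ⊆ closedBall 0 r := fun n => by
    have h1 : tsupport (K n) ⊆ tsupport ((φ n).normed volume) :=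
      closure_mono fun w hw h0 => hw (by simp [K, h0])
    rw [(φ n).tsupport_normed_eq] at h1
    exact h1.trans (closedBall_subset_closedBall (hφr n))
  have hKc : ∀ n, HasCompactSupport (K n) := fun n =>
    (isCompact_closedBall 0 r).of_isClosed_subset (isClosed_tsupport _) (hKs n)
  have hK1 : ∀ n, ∫ t, ‖K n t‖ = 1 := fun n => by
    rw [← (φ n).integral_normed (μ := volume)]
    congr 1; ext t
    simp only [K, Complex.norm_real, Real.norm_eq_abs]
    exact abs_of_nonneg ((φ n).nonneg_normed t)
  have hKB : ∀ n z, ‖mollify (K n) v z‖ ≤ B := fun n z => by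
    have := norm_mollify_le ((hK n).continuous.integrable_of_hasCompactSupport (hKc n)) hB z
    rwa [hK1, mul_one] at this
  have hlim : ∀ᵐ z, Filter.Tendsto (fun n => mollify (K n) v z) Filter.atTop (nhds (v z)) := by
    have h := ContDiffBump.ae_convolution_tendsto_right_of_locallyIntegrable (μ := volume) (K := 2)
      hφ0 (Filter.Eventually.of_forall fun n => by
        change r / (n + 1) ≤ 2 * (r / (n + 1) / 2); linarith) hv
    filter_upwards [h] with z hz
    refine hz.congr fun n => ?_
    rw [mollify, convolution_eq_swap]
    refine integral_congr_ae (Filter.Eventually.of_forall fun t => ?_)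
    simp [K, mul_comm]
  filter_upwards [hlim] with z hz hzr
  rw [mem_ball] at hzr
  have hmean : ∀ n, mollify κ (mollify (K n) v) z = mollify (K n) v z := fun n => by
    refine mollify_eq_of_differentiableOn hκ.continuous hκc hinv hint (R := 2 * r) (by linarith)
      hκs (contDiff_mollify (hK n) (hKc n) hv).continuous (hKB n) fun y hy => ?_
    rw [mem_ball] at hy
    refine (differentiableAt_mollify (hK n) (hKc n) hv (hKs n) hw
      ((closedBall_subset_ball' ?_).trans hz₀)).differentiableWithinAt
    linarith [dist_triangle y z z₀]
  have hdct : Filter.Tendsto (fun n => mollify κ (mollify (K n) v) z) Filter.atTop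
      (nhds (mollify κ v z)) := by
    have hκi : Integrable fun t => κ (z - t) :=
      (hκ.continuous.integrable_of_hasCompactSupport hκc).comp_sub_left z
    refine tendsto_integral_of_dominated_convergence (fun t => B * ‖κ (z - t)‖) (fun n => ?_)
      (hκi.norm.const_mul B) (fun n => Filter.Eventually.of_forall fun t => ?_) ?_
    · exact ((contDiff_mollify (hK n) (hKc n) hv).continuous.mul
        (hκ.continuous.comp (continuous_const.sub continuous_id))).aestronglyMeasurable
    · rw [norm_mul]
      exact mul_le_mul_of_nonneg_right (hKB n t) (norm_nonneg _)
    · filter_upwards [hlim] with t ht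
      exact ht.mul_const _
  simp only [hmean] at hdct
  exact tendsto_nhds_unique hdct hz

/-- **Weyl's lemma** for `∂̄`: a bounded function on `Ω` whose distributional `∂̄` vanishes agrees
a.e. with a holomorphic function. -/
theorem exists_holomorphic_of_weak {Ω : Set (Fin d → ℂ)} (hΩ : IsOpen Ω) {u : (Fin d → ℂ) → ℂ}
    (hu : MemLp u ∞ (volume.restrict Ω))
    (hw : ∀ k (φ : (Fin d → ℂ) → ℂ), ContDiff ℝ (⊤ : ℕ∞) φ → HasCompactSupport φ →
      tsupport φ ⊆ Ω → ∫ z in Ω, u z * wirtV k φ z = 0) :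
    ∃ g : (Fin d → ℂ) → ℂ, DifferentiableOn ℂ g Ω ∧ g =ᵐ[volume.restrict Ω] u := by
  set v := Ω.indicator u with hv_def
  have hvtop : MemLp v ∞ volume := (memLp_indicator_iff_restrict hΩ.measurableSet).2 hu
  have hv : LocallyIntegrable v := hvtop.locallyIntegrable le_top
  have hB : ∀ᵐ t, ‖v t‖ ≤ (eLpNorm v ∞ volume).toReal := by
    filter_upwards [ae_le_eLpNormEssSup (f := v) (μ := volume)] with t ht
    rw [← eLpNorm_exponent_top] at ht
    simpa using ENNReal.toReal_mono hvtop.eLpNorm_ne_top ht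
  have hw' : ∀ k (φ : (Fin d → ℂ) → ℂ), ContDiff ℝ (⊤ : ℕ∞) φ → HasCompactSupport φ →
      tsupport φ ⊆ Ω → ∫ z, v z * wirtV k φ z = 0 := fun k φ h1 h2 h3 => by
    rw [← hw k φ h1 h2 h3, ← integral_indicator hΩ.measurableSet]
    congr 1; ext z
    by_cases hz : z ∈ Ω <;> simp [hv_def, hz]
  have hloc : ∀ z : Ω, ∃ r > 0, ball (z : Fin d → ℂ) r ⊆ Ω ∧ ∃ g : (Fin d → ℂ) → ℂ,
      DifferentiableOn ℂ g (ball (z : Fin d → ℂ) r) ∧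
        ∀ᵐ y, y ∈ ball (z : Fin d → ℂ) r → g y = v y := by
    intro z
    obtain ⟨R, hR, hRΩ⟩ := Metric.isOpen_iff.mp hΩ z z.2
    refine ⟨R / 4, by positivity, (ball_subset_ball (by linarith)).trans hRΩ, ?_⟩
    exact exists_local_holomorphic hv hB hw' (by positivity)
      ((ball_subset_ball (by linarith)).trans hRΩ)
  choose r hr hrΩ G hG hGv using hloc
  classical
  let g : (Fin d → ℂ) → ℂ := fun y => if hy : y ∈ Ω then G ⟨y, hy⟩ y else 0
  -- the local representatives agree on overlaps, being continuous and a.e. equal to `v`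
  have hgG : ∀ z : Ω, Set.EqOn g (G z) (ball (z : Fin d → ℂ) (r z)) := by
    intro z y hy
    have hyΩ : y ∈ Ω := hrΩ z hy
    have hae : G ⟨y, hyΩ⟩
        =ᵐ[volume.restrict (ball y (r ⟨y, hyΩ⟩) ∩ ball (z : Fin d → ℂ) (r z))] G z := by
      rw [Filter.EventuallyEq, ae_restrict_iff' (isOpen_ball.inter isOpen_ball).measurableSet]
      filter_upwards [hGv ⟨y, hyΩ⟩, hGv z] with x hx1 hx2 hx
      rw [hx1 hx.1, hx2 hx.2]
    have := Measure.eqOn_open_of_ae_eq hae (isOpen_ball.inter isOpen_ball)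
      ((hG ⟨y, hyΩ⟩).continuousOn.mono Set.inter_subset_left)
      ((hG z).continuousOn.mono Set.inter_subset_right)
    simp only [g, hyΩ, dif_pos]
    exact this ⟨mem_ball_self (hr _), hy⟩
  refine ⟨g, fun z hz => ?_, ?_⟩
  · have h1 := (hG ⟨z, hz⟩).differentiableAt (isOpen_ball.mem_nhds (mem_ball_self (hr ⟨z, hz⟩)))
    refine (h1.congr_of_eventuallyEq ?_).differentiableWithinAt
    exact (hgG ⟨z, hz⟩).eventuallyEq_of_mem (isOpen_ball.mem_nhds (mem_ball_self (hr ⟨z, hz⟩)))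
  · rw [Filter.EventuallyEq, ae_restrict_iff' hΩ.measurableSet, ae_iff]
    refine measure_null_of_locally_null _ fun z hz => ?_
    simp only [Set.mem_ofPred_eq, Classical.not_imp] at hz
    refine ⟨_, mem_nhdsWithin_of_mem_nhds
      (isOpen_ball.mem_nhds (mem_ball_self (hr ⟨z, hz.1⟩))) |> Filter.inter_mem self_mem_nhdsWithin,
      ?_⟩
    have := hGv ⟨z, hz.1⟩
    rw [ae_iff] at this
    refine measure_mono_null (fun y hy => ?_) this
    simp only [Set.mem_inter_iff, Set.mem_ofPred_eq, Classical.not_imp] at hy ⊢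
    refine ⟨hy.2, fun h => hy.1.2 ?_⟩
    rw [hgG ⟨z, hz.1⟩ hy.2, h, hv_def, Set.indicator_of_mem hy.1.1]

end Weyl

/-! ### Smoothness of holomorphic functions -/

section Smoothness

open Metric

variable {d : ℕ}

/-- Holomorphic functions of several variables are smooth: locally they are equal to their
convolution with an invariant kernel. -/
lemma contDiffOn_real_of_holomorphic {Ω : Set (Fin d → ℂ)} (hΩ : IsOpen Ω) {f : (Fin d → ℂ) → ℂ}
    (hf : DifferentiableOn ℂ f Ω) : ContDiffOn ℝ (⊤ : ℕ∞) f Ω := by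
  intro z₀ hz₀
  obtain ⟨R, hR, hRΩ⟩ := Metric.isOpen_iff.mp hΩ z₀ hz₀
  set r := R / 5 with hr_def
  have hr : 0 < r := by positivity
  let χ : ContDiffBump z₀ := ⟨3 * r, 4 * r, by positivity, by linarith⟩
  have hχ : tsupport χ ⊆ Ω := by
    rw [χ.tsupport_eq]
    exact (closedBall_subset_ball (show 4 * r < R by linarith)).trans hRΩ
  let h : (Fin d → ℂ) → ℂ := fun z => f z * ((χ z : ℝ) : ℂ)
  have hhs : tsupport h ⊆ tsupport χ :=
    closure_mono fun w hw h0 => hw (by simp [h, h0])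
  have hh : Continuous h := by
    rw [continuous_iff_continuousAt]
    intro z
    by_cases hz : z ∈ tsupport χ
    · exact (hf.differentiableAt (hΩ.mem_nhds (hχ hz))).continuousAt.mul
        (Complex.continuous_ofReal.comp χ.continuous).continuousAt
    · have : h =ᶠ[nhds z] fun _ => 0 := notMem_tsupport_iff_eventuallyEq.mp fun h1 => hz (hhs h1)
      exact continuousAt_const.congr this.symm
  have hhc : HasCompactSupport h := χ.hasCompactSupport.of_isClosed_subset (isClosed_tsupport _) hhs
  obtain ⟨B, hB⟩ := hhc.exists_bound_of_continuous hh
  obtain ⟨κ, hκ, hκs, hinv, hint⟩ := exists_invariant_kernel (d := d) hr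
  have hκc : HasCompactSupport κ :=
    (isCompact_closedBall 0 r).of_isClosed_subset (isClosed_tsupport _) hκs
  have hfh : ∀ y ∈ ball z₀ (3 * r), h y = f y := fun y hy => by
    simp [h, χ.one_of_mem_closedBall (ball_subset_closedBall hy)]
  have hev : ∀ z ∈ ball z₀ r, f z = mollify κ h z := by
    intro z hz
    rw [mollify_eq_of_differentiableOn hκ.continuous hκc hinv hint (R := 2 * r) (by linarith)
      hκs hh hB, hfh z (ball_subset_ball (by linarith) hz)]
    have hsub : ball z (2 * r) ⊆ ball z₀ (3 * r) :=
      ball_subset_ball' (by rw [mem_ball] at hz; linarith)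
    refine DifferentiableOn.congr (hf.mono (hsub.trans ?_)) fun y hy => hfh y (hsub hy)
    exact (ball_subset_ball (by linarith)).trans hRΩ
  refine ((contDiff_mollify hκ hκc hh.locallyIntegrable).contDiffAt.congr_of_eventuallyEq
    ?_).contDiffWithinAt
  filter_upwards [ball_mem_nhds z₀ hr] with z hz using hev z hz

end Smoothness

/-! ### A smooth solution of the Bézout equation -/

section Cutoff

lemma exists_bound_of_continuous_of_le_one {h : ℝ → ℝ} (hc : Continuous h)
    (h1 : ∀ t, 1 ≤ t → |h t| ≤ 1) : ∃ c, ∀ t, 0 ≤ t → |h t| ≤ c := by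
  obtain ⟨c, hc⟩ := (isCompact_Icc (a := (0 : ℝ)) (b := 1)).exists_bound_of_continuousOn
    hc.continuousOn
  refine ⟨max c 1, fun t ht => ?_⟩
  rcases le_total t 1 with h | h
  · exact (hc t ⟨ht, h⟩).trans (le_max_left _ _)
  · exact (h1 t h).trans (le_max_right _ _)

/-- A smooth function equal to `1/t` for `t ≥ 1`, with weighted bounds on `[0, ∞)`. -/
lemma exists_smooth_inv : ∃ (η : ℝ → ℝ) (c : ℝ), 1 ≤ c ∧ ContDiff ℝ (⊤ : ℕ∞) η ∧
    (∀ t, 1 ≤ t → t * η t = 1) ∧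
    ∀ t, 0 ≤ t → |η t| ≤ c ∧ √t * |η t| ≤ c ∧ t * |η t| ≤ c ∧ t * |deriv η t| ≤ c ∧
      t * √t * |deriv η t| ≤ c := by
  let η : ℝ → ℝ := fun t => Real.smoothTransition (2 * t - 1) * t⁻¹
  have hη : ContDiff ℝ (⊤ : ℕ∞) η := by
    rw [contDiff_iff_contDiffAt]
    intro t
    by_cases ht : t = 0
    · have : η =ᶠ[nhds t] fun _ => 0 := by
        have : Set.Iio (1 / 2 : ℝ) ∈ nhds t := Iio_mem_nhds (by rw [ht]; norm_num)
        filter_upwards [this] with y hy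
        have hy' : y < 1 / 2 := hy
        simp only [η]
        rw [Real.smoothTransition.zero_of_nonpos (by linarith), zero_mul]
      exact contDiffAt_const.congr_of_eventuallyEq this
    · exact (Real.smoothTransition.contDiffAt.comp t (by fun_prop)).mul (contDiffAt_inv ℝ ht)
  have h1 : ∀ t, 1 ≤ t → η t = t⁻¹ := fun t ht => by
    simp only [η]; rw [Real.smoothTransition.one_of_one_le (by linarith), one_mul]
  have hd' : ∀ t, 1 < t → deriv η t = -(t ^ 2)⁻¹ := fun t ht => by
    have : η =ᶠ[nhds t] fun t => t⁻¹ := by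
      filter_upwards [Ioi_mem_nhds ht] with y hy using h1 y (le_of_lt hy)
    rw [this.deriv_eq, deriv_inv]
  have hcd : Continuous (deriv η) := hη.continuous_deriv (by simp)
  have hd : ∀ t, 1 ≤ t → deriv η t = -(t ^ 2)⁻¹ := by
    have hcl : Set.EqOn (deriv η) (fun t => -(t ^ 2)⁻¹) (closure (Set.Ioi 1)) := by
      refine Set.EqOn.of_subset_closure (s := Set.Ioi (1 : ℝ)) (fun t ht => hd' t ht)
        hcd.continuousOn ?_ subset_closure subset_rfl
      rw [closure_Ioi]
      refine ContinuousOn.neg (ContinuousOn.inv₀ (by fun_prop) fun t ht => ?_)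
      have : (1 : ℝ) ≤ t := ht
      positivity
    intro t ht
    exact hcl (by rw [closure_Ioi]; exact ht)
  have hsq : ∀ t : ℝ, 1 ≤ t → √t ≤ t := fun t ht => by
    rw [Real.sqrt_le_left (by linarith)]; nlinarith
  obtain ⟨c1, hc1⟩ := exists_bound_of_continuous_of_le_one hη.continuous fun t ht => by
    rw [h1 t ht, abs_of_nonneg (by positivity)]; exact inv_le_one_of_one_le₀ ht
  obtain ⟨c2, hc2⟩ := exists_bound_of_continuous_of_le_one (h := fun t => √t * η t)
    (Real.continuous_sqrt.mul hη.continuous) fun t ht => by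
    rw [h1 t ht, abs_of_nonneg (by positivity), ← div_eq_mul_inv]
    exact div_le_one_of_le₀ (hsq t ht) (by linarith)
  obtain ⟨c3, hc3⟩ := exists_bound_of_continuous_of_le_one (h := fun t => t * η t)
    (continuous_id.mul hη.continuous) fun t ht => by
    have ht0 : t ≠ 0 := by linarith
    simp [h1 t ht, ht0]
  obtain ⟨c4, hc4⟩ := exists_bound_of_continuous_of_le_one (h := fun t => t * deriv η t)
    (continuous_id.mul hcd) fun t ht => by
    have ht0 : 0 < t := by linarith
    rw [hd t ht, mul_neg, abs_neg, abs_of_nonneg (by positivity), ← div_eq_mul_inv]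
    exact div_le_one_of_le₀ (by nlinarith) (by positivity)
  obtain ⟨c5, hc5⟩ := exists_bound_of_continuous_of_le_one (h := fun t => t * √t * deriv η t)
    ((continuous_id.mul Real.continuous_sqrt).mul hcd) fun t ht => by
    have ht0 : 0 < t := by linarith
    rw [hd t ht, mul_neg, abs_neg, abs_of_nonneg (by positivity), ← div_eq_mul_inv]
    exact div_le_one_of_le₀ (by nlinarith [hsq t ht]) (by positivity)
  have n1 := (abs_nonneg _).trans (hc1 0 le_rfl)
  have n2 := (abs_nonneg _).trans (hc2 0 le_rfl)
  have n3 := (abs_nonneg _).trans (hc3 0 le_rfl)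
  have n4 := (abs_nonneg _).trans (hc4 0 le_rfl)
  have n5 := (abs_nonneg _).trans (hc5 0 le_rfl)
  refine ⟨η, 1 + c1 + c2 + c3 + c4 + c5, by linarith, hη, fun t ht => ?_, fun t ht => ?_⟩
  · rw [h1 t ht, mul_inv_cancel₀ (by linarith)]
  · have b1 := hc1 t ht
    have b2 := hc2 t ht
    have b3 := hc3 t ht
    have b4 := hc4 t ht
    have b5 := hc5 t ht
    rw [abs_mul, abs_of_nonneg (by positivity)] at b2 b3 b4 b5
    refine ⟨?_, ?_, ?_, ?_, ?_⟩ <;> linarith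

/-- The function of `exists_smooth_inv`, rescaled to be `1/s` for `s ≥ σ`. -/
lemma exists_smooth_inv_scaled : ∃ c : ℝ, 1 ≤ c ∧ ∀ σ : ℝ, 0 < σ → ∃ η : ℝ → ℝ,
    ContDiff ℝ (⊤ : ℕ∞) η ∧ (∀ s, σ ≤ s → s * η s = 1) ∧
    ∀ s, 0 ≤ s → |η s| ≤ c / σ ∧ √s * |η s| ≤ c / √σ ∧ s * |η s| ≤ c ∧
      s * |deriv η s| ≤ c / σ ∧ s * √s * |deriv η s| ≤ c / √σ := by
  obtain ⟨η, c, hc, hη, hη1, hb⟩ := exists_smooth_inv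
  refine ⟨c, hc, fun σ hσ => ⟨fun s => η (s / σ) / σ, ?_, fun s hs => ?_, fun s hs => ?_⟩⟩
  · exact (hη.comp (contDiff_id.div_const σ)).div_const σ
  · have := hη1 (s / σ) ((one_le_div hσ).2 hs)
    rw [← this]; ring
  · obtain ⟨t, ht, rfl⟩ : ∃ t, 0 ≤ t ∧ s = σ * t := ⟨s / σ, by positivity, by field_simp⟩
    have hσt : σ * t / σ = t := by field_simp
    have hder : deriv (fun s => η (s / σ) / σ) (σ * t) = deriv η t / σ / σ := by
      have h1 : HasDerivAt η (deriv η t) (σ * t / σ) := by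
        rw [hσt]; exact (hη.differentiable (by simp) t).hasDerivAt
      have h2 := (h1.comp (σ * t) ((hasDerivAt_id (σ * t)).div_const σ)).div_const σ
      have h3 := h2.deriv
      simp only [Function.comp_def, id] at h3
      rw [h3]; ring
    obtain ⟨b1, b2, b3, b4, b5⟩ := hb t ht
    rw [hder]
    simp only [hσt, abs_div, abs_of_pos hσ]
    obtain ⟨τ, hτ, rfl⟩ : ∃ τ, 0 < τ ∧ σ = τ ^ 2 := ⟨√σ, by positivity, (Real.sq_sqrt hσ.le).symm⟩
    rw [Real.sqrt_mul (by positivity), Real.sqrt_sq hτ.le]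
    refine ⟨by gcongr, ?_, ?_, ?_, ?_⟩
    · rw [show τ * √t * (|η t| / τ ^ 2) = √t * |η t| / τ by field_simp]; gcongr
    · rw [show τ ^ 2 * t * (|η t| / τ ^ 2) = t * |η t| by field_simp]; exact b3
    · rw [show τ ^ 2 * t * (|deriv η t| / τ ^ 2 / τ ^ 2) = t * |deriv η t| / τ ^ 2 by field_simp]
      gcongr
    · rw [show τ ^ 2 * t * (τ * √t) * (|deriv η t| / τ ^ 2 / τ ^ 2)
        = t * √t * |deriv η t| / τ by field_simp]
      gcongr

/-- **Bounded smooth solutions of the Bézout equation.** The function `f L` enters `φ` only through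
`1 / f L`, on a set where it is bounded below; hence the bound on `∂̄φ` involves only the
derivatives of the other functions. -/
lemma exists_smooth_bezout : ∃ c : ℝ, 1 ≤ c ∧ ∀ {d N : ℕ} {Ω : Set (Fin d → ℂ)}, IsOpen Ω →
    ∀ (f : Fin N → (Fin d → ℂ) → ℂ) (L : Fin N) (δ M : ℝ), 0 < δ → 0 ≤ M →
    (∀ j, DifferentiableOn ℂ (f j) Ω) →
    (∀ j, j ≠ L → ∀ z ∈ Ω, ∀ k, ‖fderiv ℂ (f j) z (Pi.single k 1)‖ ≤ M) →
    (∀ z ∈ Ω, δ ≤ ∑ j, ‖f j z‖) →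
    ∃ φ : Fin N → (Fin d → ℂ) → ℂ, (∀ j, ContDiffOn ℝ (⊤ : ℕ∞) (φ j) Ω) ∧
      (∀ z ∈ Ω, ∑ j, f j z * φ j z = 1) ∧
      (∀ j, ∀ z ∈ Ω, ‖φ j z‖ ≤ c * N / δ) ∧
      ∀ j k, ∀ z ∈ Ω, ‖wirtV k (φ j) z‖ ≤ c * N ^ 2 * M / δ ^ 2 := by
  obtain ⟨c, hc, hη⟩ := exists_smooth_inv_scaled
  refine ⟨8 * c, by linarith, ?_⟩
  intro d N Ω hΩ f L δ M hδ hM hf hfM hfδ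
  have hN : 0 < (N : ℝ) := by exact_mod_cast L.pos
  have hN1 : 1 ≤ (N : ℝ) := by exact_mod_cast L.pos
  have hsN : √(N : ℝ) ≤ N := by rw [Real.sqrt_le_left hN.le]; nlinarith
  set σ : ℝ := δ ^ 2 / (4 * N) with hσ_def
  have hσ : 0 < σ := by positivity
  obtain ⟨η, hηs, hη1, hηb⟩ := hη σ hσ
  have hσinv : 1 / σ = 4 * N / δ ^ 2 := by rw [hσ_def]; field_simp
  have hσsqrt : 1 / √σ ≤ 2 * N / δ := by
    have h1 : √σ = δ / (2 * √N) := by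
      rw [hσ_def, Real.sqrt_div (by positivity), Real.sqrt_sq hδ.le,
        Real.sqrt_mul (by norm_num), show (4 : ℝ) = 2 ^ 2 by norm_num,
        Real.sqrt_sq (by norm_num)]
    rw [h1, one_div_div]
    gcongr
  let s : (Fin d → ℂ) → ℝ := fun z => ∑ j ∈ Finset.univ.erase L, ‖f j z‖ ^ 2
  have hs0 : ∀ z, 0 ≤ s z := fun z => Finset.sum_nonneg fun j _ => by positivity
  have hfsmooth : ∀ j, ContDiffOn ℝ (⊤ : ℕ∞) (f j) Ω := fun j =>
    contDiffOn_real_of_holomorphic hΩ (hf j)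
  have hssmooth : ContDiffOn ℝ (⊤ : ℕ∞) s Ω :=
    ContDiffOn.sum fun j _ => (hfsmooth j).norm_sq ℝ
  have hfs : ∀ j, j ≠ L → ∀ z, ‖f j z‖ ≤ √(s z) := fun j hj z => by
    refine Real.le_sqrt_of_sq_le ?_
    exact Finset.single_le_sum (f := fun j => ‖f j z‖ ^ 2) (fun i _ => by positivity)
      (Finset.mem_erase.2 ⟨hj, Finset.mem_univ j⟩)
  -- where `f L` is small, the other functions are large
  have hsmall : ∀ z ∈ Ω, ‖f L z‖ < δ / 2 → σ < s z := fun z hz h => by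
    have h1 := hfδ z hz
    rw [← Finset.add_sum_erase _ _ (Finset.mem_univ L)] at h1
    have h2 : δ / 2 < ∑ j ∈ Finset.univ.erase L, ‖f j z‖ := by linarith
    have h3 := sq_sum_le_card_mul_sum_sq (s := Finset.univ.erase L) (f := fun j => ‖f j z‖)
    have h4 : ((Finset.univ.erase L).card : ℝ) ≤ N := by
      exact_mod_cast (Finset.card_le_univ _).trans (by simp)
    have h5 : (δ / 2) ^ 2 < N * s z := calc
      (δ / 2) ^ 2 < (∑ j ∈ Finset.univ.erase L, ‖f j z‖) ^ 2 := by gcongr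
      _ ≤ _ := h3
      _ ≤ N * s z := mul_le_mul_of_nonneg_right h4 (hs0 z)
    rw [hσ_def, div_lt_iff₀ (by positivity)]
    nlinarith
  have hsdiff : ∀ z ∈ Ω, DifferentiableAt ℝ s z := fun z hz =>
    (hssmooth.contDiffAt (hΩ.mem_nhds hz)).differentiableAt (by simp)
  have hfdiff : ∀ j, ∀ z ∈ Ω, DifferentiableAt ℂ (f j) z := fun j z hz =>
    (hf j).differentiableAt (hΩ.mem_nhds hz)
  have hηdiff : Differentiable ℝ η := hηs.differentiable (by simp)
  -- the bound on `∂̄s`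
  have hsbar : ∀ k, ∀ z ∈ Ω, ‖wirtV k (fun z => (s z : ℂ)) z‖ ≤ N * √(s z) * M := fun k z hz => by
    have e : (fun z => (s z : ℂ))
        = fun z => ∑ j ∈ Finset.univ.erase L, f j z • (starRingEnd ℂ) (f j z) := by
      ext z
      simp only [s, Complex.ofReal_sum, smul_eq_mul, Complex.mul_conj, Complex.normSq_eq_norm_sq]
    have hconj : ∀ j, DifferentiableAt ℝ (fun z => (starRingEnd ℂ) (f j z)) z := fun j =>
      (Complex.conjCLE : ℂ →L[ℝ] ℂ).differentiableAt.comp z ((hfdiff j z hz).restrictScalars ℝ)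
    rw [e, wirtV_sum _ _ fun j _ => ((hfdiff j z hz).restrictScalars ℝ).fun_smul (hconj j)]
    refine (norm_sum_le _ _).trans ?_
    have h1 : ∀ j ∈ Finset.univ.erase L,
        ‖wirtV k (fun z => f j z • (starRingEnd ℂ) (f j z)) z‖ ≤ √(s z) * M := fun j hj => by
      rw [wirtV_smul k ((hfdiff j z hz).restrictScalars ℝ) (hconj j),
        wirtV_of_holomorphic k (hfdiff j z hz), wirtV_conj k (hfdiff j z hz), zero_smul, zero_add,
        norm_smul, RCLike.norm_conj]
      have hj' := (Finset.mem_erase.1 hj).1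
      exact mul_le_mul (hfs j hj' z) (hfM j hj' z hz k) (norm_nonneg _) (Real.sqrt_nonneg _)
    refine (Finset.sum_le_card_nsmul _ _ _ h1).trans ?_
    rw [nsmul_eq_mul, mul_assoc]
    refine mul_le_mul_of_nonneg_right ?_ (by positivity)
    exact_mod_cast (Finset.card_le_univ _).trans (by simp)
  let φ : Fin N → (Fin d → ℂ) → ℂ := fun j z =>
    if j = L then ((1 - s z * η (s z) : ℝ) : ℂ) * (f L z)⁻¹
    else (starRingEnd ℂ) (f j z) • ((η (s z) : ℝ) : ℂ)
  have hφL : φ L = fun z => ((1 - s z * η (s z) : ℝ) : ℂ) * (f L z)⁻¹ := by ext z; simp [φ]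
  have hφj : ∀ j, j ≠ L → φ j = fun z => (starRingEnd ℂ) (f j z) • ((η (s z) : ℝ) : ℂ) :=
    fun j hj => by ext z; simp [φ, hj]
  have hφL0 : ∀ z ∈ Ω, σ < s z → φ L =ᶠ[nhds z] fun _ => 0 := fun z hz h => by
    filter_upwards [(hsdiff z hz).continuousAt.eventually (Ioi_mem_nhds h)] with y hy
    simp only [hφL, hη1 (s y) (le_of_lt hy)]; simp
  refine ⟨φ, fun j => ?_, fun z hz => ?_, fun j z hz => ?_, fun j k z hz => ?_⟩
  · intro z hz
    have hsz := hssmooth.contDiffAt (hΩ.mem_nhds hz)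
    have hηz : ContDiffAt ℝ (⊤ : ℕ∞) (fun z => η (s z)) z := hηs.contDiffAt.comp z hsz
    refine ContDiffAt.contDiffWithinAt ?_
    by_cases hj : j = L
    · subst hj
      by_cases h0 : f j z = 0
      · exact contDiffAt_const.congr_of_eventuallyEq
          (hφL0 z hz (hsmall z hz (by rw [h0, norm_zero]; positivity)))
      · rw [hφL]
        refine ContDiffAt.mul ?_ (((hfsmooth j).contDiffAt (hΩ.mem_nhds hz)).inv h0)
        exact Complex.ofRealCLM.contDiff.contDiffAt.comp z
          (contDiffAt_const.sub (hsz.mul hηz))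
    · rw [hφj j hj]
      exact ((Complex.conjCLE : ℂ →L[ℝ] ℂ).contDiff.contDiffAt.comp z
        ((hfsmooth j).contDiffAt (hΩ.mem_nhds hz))).smul
        (Complex.ofRealCLM.contDiff.contDiffAt.comp z hηz)
  · rw [← Finset.add_sum_erase _ _ (Finset.mem_univ L)]
    have h1 : ∑ j ∈ Finset.univ.erase L, f j z * φ j z = ((s z * η (s z) : ℝ) : ℂ) := by
      simp only [s, Finset.sum_mul, Complex.ofReal_sum]
      refine Finset.sum_congr rfl fun j hj => ?_
      simp only [hφj j (Finset.mem_erase.1 hj).1, smul_eq_mul]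
      rw [← mul_assoc, Complex.mul_conj, Complex.normSq_eq_norm_sq, ← Complex.ofReal_mul]
    have h2 : f L z * φ L z = ((1 - s z * η (s z) : ℝ) : ℂ) := by
      by_cases h0 : f L z = 0
      · rw [hη1 _ (hsmall z hz (by rw [h0, norm_zero]; positivity)).le, h0]; simp
      · rw [hφL]; field_simp
    rw [h1, h2, ← Complex.ofReal_add]; simp
  · obtain ⟨-, b2, b3, -, -⟩ := hηb (s z) (hs0 z)
    by_cases hj : j = L
    · subst hj
      rcases lt_or_ge ‖f j z‖ (δ / 2) with h | h
      · rw [(hφL0 z hz (hsmall z hz h)).eq_of_nhds, norm_zero]; positivity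
      · rw [hφL, norm_mul, norm_inv, Complex.norm_real, Real.norm_eq_abs]
        have h1 : |1 - s z * η (s z)| ≤ 2 * c := by
          refine (abs_sub _ _).trans ?_
          rw [abs_mul, abs_of_nonneg (hs0 z), abs_one]
          linarith
        have h2 : ‖f j z‖⁻¹ ≤ 2 / δ := by
          rw [← inv_div]; exact inv_anti₀ (by positivity) h
        refine (mul_le_mul h1 h2 (by positivity) (by positivity)).trans ?_
        rw [show 2 * c * (2 / δ) = 4 * c * 1 / δ by ring]
        gcongr
        linarith
    · rw [hφj j hj, norm_smul, RCLike.norm_conj, Complex.norm_real, Real.norm_eq_abs]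
      calc ‖f j z‖ * |η (s z)| ≤ √(s z) * |η (s z)| := by gcongr; exact hfs j hj z
        _ ≤ c * (1 / √σ) := by rw [mul_one_div]; exact b2
        _ ≤ c * (2 * N / δ) := by gcongr
        _ = 2 * c * N / δ := by ring
        _ ≤ _ := by gcongr; norm_num
  · obtain ⟨b1, b2, b3, b4, b5⟩ := hηb (s z) (hs0 z)
    have hsq := Real.sq_sqrt (hs0 z)
    by_cases hj : j = L
    · subst hj
      rcases lt_or_ge ‖f j z‖ (δ / 2) with h | h
      · rw [wirtV_congr (hφL0 z hz (hsmall z hz h)), wirtV_const, norm_zero]; positivity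
      · have h0 : f j z ≠ 0 := norm_pos_iff.1 (lt_of_lt_of_le (by positivity) h)
        have hinv : DifferentiableAt ℂ (fun z => (f j z)⁻¹) z := (hfdiff j z hz).inv h0
        have hθ : HasDerivAt (fun t => 1 - t * η t) (-(1 * η (s z) + s z * deriv η (s z))) (s z) :=
          ((hasDerivAt_id (s z)).mul (hηdiff (s z)).hasDerivAt).const_sub 1
        have hθd : DifferentiableAt ℝ (fun z => ((1 - s z * η (s z) : ℝ) : ℂ)) z :=
          Complex.ofRealCLM.differentiableAt.comp z
            (hθ.differentiableAt.comp z (hsdiff z hz))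
        have e1 : φ j = fun z => ((1 - s z * η (s z) : ℝ) : ℂ) • (f j z)⁻¹ := hφL
        rw [e1, wirtV_smul k hθd (hinv.restrictScalars ℝ), wirtV_of_holomorphic k hinv,
          smul_zero, add_zero,
          wirtV_comp_real (η := fun t => 1 - t * η t) k hθ.differentiableAt (hsdiff z hz),
          hθ.deriv, norm_smul, norm_mul, norm_inv, Complex.norm_real, Real.norm_eq_abs, abs_neg,
          one_mul]
        have h2 : ‖f j z‖⁻¹ ≤ 2 / δ := by
          rw [← inv_div]; exact inv_anti₀ (by positivity) h
        have h3 : |η (s z) + s z * deriv η (s z)| * √(s z) ≤ 2 * c * (1 / √σ) := by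
          have h4 : |η (s z) + s z * deriv η (s z)| ≤ |η (s z)| + s z * |deriv η (s z)| := by
            refine (abs_add_le _ _).trans ?_
            rw [abs_mul, abs_of_nonneg (hs0 z)]
          calc _ ≤ (|η (s z)| + s z * |deriv η (s z)|) * √(s z) := by gcongr
            _ = √(s z) * |η (s z)| + s z * √(s z) * |deriv η (s z)| := by ring
            _ ≤ c / √σ + c / √σ := add_le_add b2 b5
            _ = _ := by ring
        calc _ ≤ |η (s z) + s z * deriv η (s z)| * (N * √(s z) * M) * (2 / δ) := by
              gcongr; exact hsbar k z hz
          _ = |η (s z) + s z * deriv η (s z)| * √(s z) * (N * M * (2 / δ)) := by ring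
          _ ≤ 2 * c * (1 / √σ) * (N * M * (2 / δ)) := by gcongr
          _ ≤ 2 * c * (2 * N / δ) * (N * M * (2 / δ)) := by gcongr
          _ = _ := by ring
    · have hconj : DifferentiableAt ℝ (fun z => (starRingEnd ℂ) (f j z)) z :=
        (Complex.conjCLE : ℂ →L[ℝ] ℂ).differentiableAt.comp z ((hfdiff j z hz).restrictScalars ℝ)
      have hηd : DifferentiableAt ℝ (fun z => ((η (s z) : ℝ) : ℂ)) z :=
        Complex.ofRealCLM.differentiableAt.comp z ((hηdiff _).comp z (hsdiff z hz))
      rw [hφj j hj, wirtV_smul k hconj hηd, wirtV_conj k (hfdiff j z hz),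
        wirtV_comp_real k (hηdiff _) (hsdiff z hz)]
      have t1 : ‖(starRingEnd ℂ) (fderiv ℂ (f j) z (Pi.single k 1)) • ((η (s z) : ℝ) : ℂ)‖
          ≤ M * (c / σ) := by
        rw [norm_smul, RCLike.norm_conj, Complex.norm_real, Real.norm_eq_abs]
        exact mul_le_mul (hfM j hj z hz k) b1 (abs_nonneg _) hM
      have t2 : ‖(starRingEnd ℂ) (f j z) • (((deriv η (s z) : ℝ) : ℂ)
          * wirtV k (fun z => (s z : ℂ)) z)‖ ≤ N * M * (c / σ) := by
        rw [norm_smul, RCLike.norm_conj, norm_mul, Complex.norm_real, Real.norm_eq_abs]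
        calc _ ≤ √(s z) * (|deriv η (s z)| * (N * √(s z) * M)) := by
              gcongr
              · exact hfs j hj z
              · exact hsbar k z hz
          _ = N * M * (√(s z) ^ 2 * |deriv η (s z)|) := by ring
          _ ≤ _ := by rw [hsq]; gcongr
      calc _ ≤ M * (c / σ) + N * M * (c / σ) := (norm_add_le _ _).trans (add_le_add t1 t2)
        _ = (1 + N) * (M * c * (1 / σ)) := by ring
        _ ≤ (2 * N) * (M * c * (1 / σ)) := by gcongr; linarith
        _ = _ := by rw [hσinv]; ring

end Cutoff

/-! ### The tower of Koszul forms -/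

section Tower

variable {N d : ℕ} {Ω : Set (Fin d → ℂ)}

/-- The classical `∂̄` of a function with values in the fibre of the Koszul complex. -/
noncomputable def dbarV (u : (Fin d → ℂ) → KoszulFibre N d) (z : Fin d → ℂ) : KoszulFibre N d :=
  ∑ k, creForm k (wirtV k u z)

/-- The coefficients of `∂̄φ`. -/
noncomputable def dbarCoeff (φ : Fin N → (Fin d → ℂ) → ℂ) (z : Fin d → ℂ) : Fin N → Fin d → ℂ :=
  fun s k => wirtV k (φ s) z

/-- The power `(∂̄φ)^n` of the vector-valued form `∂̄φ`. -/
noncomputable def koszulPow (φ : Fin N → (Fin d → ℂ) → ℂ) : ℕ → (Fin d → ℂ) → KoszulFibre N d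
  | 0, _ => koszulOne
  | n + 1, z => wedgeMat (dbarCoeff φ z) (koszulPow φ n z)

/-- The form `φ ∧ (∂̄φ)^n`. -/
noncomputable def koszulForm (φ : Fin N → (Fin d → ℂ) → ℂ) (n : ℕ) (z : Fin d → ℂ) :
    KoszulFibre N d :=
  wedgeVec (fun s => φ s z) (koszulPow φ n z)

lemma contDiffOn_linearMap (A : KoszulFibre N d →ₗ[ℂ] KoszulFibre N d)
    {u : (Fin d → ℂ) → KoszulFibre N d} (hu : ContDiffOn ℝ (⊤ : ℕ∞) u Ω) :
    ContDiffOn ℝ (⊤ : ℕ∞) (fun z => A (u z)) Ω :=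
  ((LinearMap.toContinuousLinearMap A).restrictScalars ℝ).contDiff.comp_contDiffOn hu

lemma differentiableAt_linearMap (A : KoszulFibre N d →ₗ[ℂ] KoszulFibre N d)
    {u : (Fin d → ℂ) → KoszulFibre N d} {z : Fin d → ℂ} (hu : DifferentiableAt ℝ u z) :
    DifferentiableAt ℝ (fun z => A (u z)) z :=
  ((LinearMap.toContinuousLinearMap A).restrictScalars ℝ).differentiableAt.comp z hu

lemma wirtV_linearMap (A : KoszulFibre N d →ₗ[ℂ] KoszulFibre N d) (k : Fin d)
    {u : (Fin d → ℂ) → KoszulFibre N d} {z : Fin d → ℂ} (hu : DifferentiableAt ℝ u z) :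
    wirtV k (fun z => A (u z)) z = A (wirtV k u z) :=
  wirtV_clm k (LinearMap.toContinuousLinearMap A) hu

/-- Product rule for a scalar function and a linear map. -/
lemma wirtV_smul_linearMap (A : KoszulFibre N d →ₗ[ℂ] KoszulFibre N d) (k : Fin d)
    {c : (Fin d → ℂ) → ℂ} {u : (Fin d → ℂ) → KoszulFibre N d} {z : Fin d → ℂ}
    (hc : DifferentiableAt ℝ c z) (hu : DifferentiableAt ℝ u z) :
    wirtV k (fun z => c z • A (u z)) z = wirtV k c z • A (u z) + c z • A (wirtV k u z) := by
  rw [wirtV_smul k hc (differentiableAt_linearMap A hu), wirtV_linearMap A k hu]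

lemma contDiffOn_wedgeVec {c : Fin N → (Fin d → ℂ) → ℂ} {u : (Fin d → ℂ) → KoszulFibre N d}
    (hc : ∀ s, ContDiffOn ℝ (⊤ : ℕ∞) (c s) Ω) (hu : ContDiffOn ℝ (⊤ : ℕ∞) u Ω) :
    ContDiffOn ℝ (⊤ : ℕ∞) (fun z => wedgeVec (fun s => c s z) (u z)) Ω := by
  simp only [wedgeVec_apply]
  exact ContDiffOn.sum fun s _ => (hc s).smul (contDiffOn_linearMap (cre s) hu)

lemma contDiffOn_wedgeMat (hΩ : IsOpen Ω) {φ : Fin N → (Fin d → ℂ) → ℂ}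
    {u : (Fin d → ℂ) → KoszulFibre N d} (hφ : ∀ s, ContDiffOn ℝ (⊤ : ℕ∞) (φ s) Ω)
    (hu : ContDiffOn ℝ (⊤ : ℕ∞) u Ω) :
    ContDiffOn ℝ (⊤ : ℕ∞) (fun z => wedgeMat (dbarCoeff φ z) (u z)) Ω := by
  simp only [wedgeMat_apply]
  exact ContDiffOn.sum fun s _ => ContDiffOn.sum fun k _ =>
    (contDiffOn_wirtV hΩ k (hφ s)).smul (contDiffOn_linearMap (cre s ∘ₗ creForm k) hu)

lemma contDiffOn_koszulPow (hΩ : IsOpen Ω) {φ : Fin N → (Fin d → ℂ) → ℂ}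
    (hφ : ∀ s, ContDiffOn ℝ (⊤ : ℕ∞) (φ s) Ω) (n : ℕ) :
    ContDiffOn ℝ (⊤ : ℕ∞) (koszulPow φ n) Ω := by
  induction n with
  | zero => exact contDiffOn_const
  | succ n ih => exact contDiffOn_wedgeMat hΩ hφ ih

lemma contDiffOn_koszulForm (hΩ : IsOpen Ω) {φ : Fin N → (Fin d → ℂ) → ℂ}
    (hφ : ∀ s, ContDiffOn ℝ (⊤ : ℕ∞) (φ s) Ω) (n : ℕ) :
    ContDiffOn ℝ (⊤ : ℕ∞) (koszulForm φ n) Ω :=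
  contDiffOn_wedgeVec hφ (contDiffOn_koszulPow hΩ hφ n)

/-- Leibniz rule: `∂̄(∂̄φ ∧ u) = -∂̄φ ∧ ∂̄u`. -/
lemma dbarV_wedgeMat (hΩ : IsOpen Ω) {φ : Fin N → (Fin d → ℂ) → ℂ}
    {u : (Fin d → ℂ) → KoszulFibre N d} (hφ : ∀ s, ContDiffOn ℝ (⊤ : ℕ∞) (φ s) Ω)
    (hu : ContDiffOn ℝ (⊤ : ℕ∞) u Ω) {z : Fin d → ℂ} (hz : z ∈ Ω) :
    dbarV (fun z => wedgeMat (dbarCoeff φ z) (u z)) z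
      = -wedgeMat (dbarCoeff φ z) (dbarV u z) := by
  have hud : DifferentiableAt ℝ u z :=
    (hu.contDiffAt (hΩ.mem_nhds hz)).differentiableAt (by simp)
  have hbd : ∀ s l, DifferentiableAt ℝ (wirtV l (φ s)) z := fun s l =>
    ((contDiffOn_wirtV hΩ l (hφ s)).contDiffAt (hΩ.mem_nhds hz)).differentiableAt (by simp)
  have hterm : ∀ s l, DifferentiableAt ℝ
      (fun z => wirtV l (φ s) z • (cre s ∘ₗ creForm l) (u z)) z := fun s l =>
    (hbd s l).fun_smul (differentiableAt_linearMap _ hud)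
  have h1 : ∀ k, wirtV k (fun z => wedgeMat (dbarCoeff φ z) (u z)) z
      = ∑ s, ∑ l, (wirtV k (wirtV l (φ s)) z • cre s (creForm l (u z))
        + wirtV l (φ s) z • cre s (creForm l (wirtV k u z))) := fun k => by
    have e : (fun z => wedgeMat (dbarCoeff φ z) (u z))
        = fun z => ∑ s, ∑ l, wirtV l (φ s) z • (cre s ∘ₗ creForm l) (u z) := by
      ext1 z; rw [wedgeMat_apply]; rfl
    rw [e, wirtV_sum _ _ fun s _ => DifferentiableAt.fun_sum fun l _ => hterm s l]
    refine Finset.sum_congr rfl fun s _ => ?_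
    rw [wirtV_sum _ _ fun l _ => hterm s l]
    refine Finset.sum_congr rfl fun l _ => ?_
    rw [wirtV_smul_linearMap _ k (hbd s l) hud]; rfl
  have h2 : ∀ s, ∑ k, ∑ l, wirtV k (wirtV l (φ s)) z • creForm k (cre s (creForm l (u z))) = 0 :=
    fun s => sum_sum_eq_zero_of_antisymm _ fun k l => by
      rw [wirtV_comm k l ((hφ s).contDiffAt (hΩ.mem_nhds hz)), creForm_cre, creForm_cre,
        creForm_creForm, map_neg, smul_neg]
  simp only [dbarV, h1, map_sum, map_add, map_smul, Finset.sum_add_distrib]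
  have h3 : ∑ k, ∑ s, ∑ l, wirtV k (wirtV l (φ s)) z • creForm k (cre s (creForm l (u z))) = 0 := by
    rw [Finset.sum_comm]
    exact Finset.sum_eq_zero fun s _ => h2 s
  rw [h3, zero_add, ← Finset.sum_neg_distrib]
  refine Finset.sum_congr rfl fun k _ => ?_
  rw [wedgeMat_apply]
  simp only [← Finset.sum_neg_distrib]
  refine Finset.sum_congr rfl fun s _ => Finset.sum_congr rfl fun l _ => ?_
  rw [creForm_cre, creForm_creForm, map_neg, smul_neg]; rfl

/-- Leibniz rule: `∂̄(φ ∧ u) = ∂̄φ ∧ u + φ ∧ ∂̄u`. -/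
lemma dbarV_wedgeVec (hΩ : IsOpen Ω) {φ : Fin N → (Fin d → ℂ) → ℂ}
    {u : (Fin d → ℂ) → KoszulFibre N d} (hφ : ∀ s, ContDiffOn ℝ (⊤ : ℕ∞) (φ s) Ω)
    (hu : ContDiffOn ℝ (⊤ : ℕ∞) u Ω) {z : Fin d → ℂ} (hz : z ∈ Ω) :
    dbarV (fun z => wedgeVec (fun s => φ s z) (u z)) z
      = wedgeMat (dbarCoeff φ z) (u z) + wedgeVec (fun s => φ s z) (dbarV u z) := by
  have hud : DifferentiableAt ℝ u z :=
    (hu.contDiffAt (hΩ.mem_nhds hz)).differentiableAt (by simp)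
  have hφd : ∀ s, DifferentiableAt ℝ (φ s) z := fun s =>
    ((hφ s).contDiffAt (hΩ.mem_nhds hz)).differentiableAt (by simp)
  have hterm : ∀ s, DifferentiableAt ℝ (fun z => φ s z • cre s (u z)) z := fun s =>
    (hφd s).fun_smul (differentiableAt_linearMap (cre s) hud)
  have h1 : ∀ k, wirtV k (fun z => wedgeVec (fun s => φ s z) (u z)) z
      = ∑ s, (wirtV k (φ s) z • cre s (u z) + φ s z • cre s (wirtV k u z)) := fun k => by
    simp only [wedgeVec_apply]
    rw [wirtV_sum _ _ fun s _ => hterm s]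
    exact Finset.sum_congr rfl fun s _ => wirtV_smul_linearMap _ k (hφd s) hud
  simp only [dbarV, h1, map_sum, map_add, map_smul, Finset.sum_add_distrib]
  congr 1
  · rw [wedgeMat_apply, Finset.sum_comm]
    refine Finset.sum_congr rfl fun s _ => Finset.sum_congr rfl fun k _ => ?_
    rw [creForm_cre]; rfl
  · refine Finset.sum_congr rfl fun k _ => ?_
    rw [wedgeVec_apply]
    exact Finset.sum_congr rfl fun s _ => by rw [creForm_cre]

lemma dbarV_koszulPow (hΩ : IsOpen Ω) {φ : Fin N → (Fin d → ℂ) → ℂ}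
    (hφ : ∀ s, ContDiffOn ℝ (⊤ : ℕ∞) (φ s) Ω) (n : ℕ) {z : Fin d → ℂ} (hz : z ∈ Ω) :
    dbarV (koszulPow φ n) z = 0 := by
  induction n with
  | zero =>
    refine Finset.sum_eq_zero fun k _ => ?_
    have : wirtV k (koszulPow φ 0) z = 0 := wirtV_const k (koszulOne : KoszulFibre N d) z
    rw [this, map_zero]
  | succ n ih =>
    have := dbarV_wedgeMat hΩ hφ (contDiffOn_koszulPow hΩ hφ n) hz
    rw [ih, map_zero, neg_zero] at this
    exact this

lemma dbarV_koszulForm (hΩ : IsOpen Ω) {φ : Fin N → (Fin d → ℂ) → ℂ}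
    (hφ : ∀ s, ContDiffOn ℝ (⊤ : ℕ∞) (φ s) Ω) (n : ℕ) {z : Fin d → ℂ} (hz : z ∈ Ω) :
    dbarV (koszulForm φ n) z = koszulPow φ (n + 1) z := by
  have := dbarV_wedgeVec hΩ hφ (contDiffOn_koszulPow hΩ hφ n) hz
  rw [dbarV_koszulPow hΩ hφ n hz, map_zero, add_zero] at this
  exact this

/-- Since `∑ f_s φ_s = 1` with `f` holomorphic, `f` contracts `∂̄φ` to zero. -/
lemma sum_mul_dbarCoeff_eq_zero (hΩ : IsOpen Ω) {f φ : Fin N → (Fin d → ℂ) → ℂ}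
    (hf : ∀ s, DifferentiableOn ℂ (f s) Ω) (hφ : ∀ s, ContDiffOn ℝ (⊤ : ℕ∞) (φ s) Ω)
    (hfφ : ∀ z ∈ Ω, ∑ s, f s z * φ s z = 1) {z : Fin d → ℂ} (hz : z ∈ Ω) (k : Fin d) :
    ∑ s, f s z * dbarCoeff φ z s k = 0 := by
  have hfd : ∀ s, DifferentiableAt ℂ (f s) z := fun s => (hf s).differentiableAt (hΩ.mem_nhds hz)
  have hφd : ∀ s, DifferentiableAt ℝ (φ s) z := fun s =>
    ((hφ s).contDiffAt (hΩ.mem_nhds hz)).differentiableAt (by simp)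
  have h1 : (fun z => ∑ s, f s z • φ s z) =ᶠ[nhds z] fun _ => 1 := by
    filter_upwards [hΩ.mem_nhds hz] with y hy using hfφ y hy
  have h2 := wirtV_congr (k := k) h1
  rw [wirtV_const, wirtV_sum _ _ fun s _ => ((hfd s).restrictScalars ℝ).fun_smul (hφd s)] at h2
  rw [← h2]
  refine Finset.sum_congr rfl fun s _ => ?_
  rw [wirtV_smul k ((hfd s).restrictScalars ℝ) (hφd s), wirtV_of_holomorphic k (hfd s), zero_smul,
    zero_add]
  rfl

lemma contract_koszulPow {c : Fin N → ℂ} {φ : Fin N → (Fin d → ℂ) → ℂ} {z : Fin d → ℂ}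
    (h : ∀ k, ∑ s, c s * dbarCoeff φ z s k = 0) (n : ℕ) : contract c (koszulPow φ n z) = 0 := by
  induction n with
  | zero => exact contract_koszulOne c
  | succ n ih =>
    have := contract_wedgeMat c (dbarCoeff φ z) h (koszulPow φ n z)
    rw [ih, map_zero, neg_zero] at this
    exact this

lemma contract_koszulForm {c : Fin N → ℂ} {φ : Fin N → (Fin d → ℂ) → ℂ} {z : Fin d → ℂ}
    (h1 : ∑ s, c s * φ s z = 1) (h : ∀ k, ∑ s, c s * dbarCoeff φ z s k = 0) (n : ℕ) :
    contract c (koszulForm φ n z) = koszulPow φ n z := by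
  rw [koszulForm, contract_wedgeVec _ _ h1, contract_koszulPow h, map_zero, sub_zero]

lemma hasFormDegree_koszulPow (φ : Fin N → (Fin d → ℂ) → ℂ) (n : ℕ) (z : Fin d → ℂ) :
    HasFormDegree n (koszulPow φ n z) := by
  induction n with
  | zero => exact hasFormDegree_koszulOne
  | succ n ih => exact ih.wedgeMat _

lemma hasFormDegree_koszulForm (φ : Fin N → (Fin d → ℂ) → ℂ) (n : ℕ) (z : Fin d → ℂ) :
    HasFormDegree n (koszulForm φ n z) :=
  (hasFormDegree_koszulPow φ n z).wedgeVec _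

lemma norm_koszulPow_le {φ : Fin N → (Fin d → ℂ) → ℂ} {z : Fin d → ℂ} {B : ℝ} (hB0 : 0 ≤ B)
    (hB : ∀ s k, ‖dbarCoeff φ z s k‖ ≤ B) (n : ℕ) : ‖koszulPow φ n z‖ ≤ (N * d * B) ^ n := by
  induction n with
  | zero => rw [pow_zero]; exact norm_koszulOne
  | succ n ih =>
    refine (norm_wedgeMat_le hB _).trans ?_
    rw [pow_succ, mul_comm ((N * d * B) ^ n)]
    gcongr

lemma norm_koszulForm_le {φ : Fin N → (Fin d → ℂ) → ℂ} {z : Fin d → ℂ} {A B : ℝ} (hA0 : 0 ≤ A)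
    (hA : ∀ s, ‖φ s z‖ ≤ A) (hB0 : 0 ≤ B) (hB : ∀ s k, ‖dbarCoeff φ z s k‖ ≤ B) (n : ℕ) :
    ‖koszulForm φ n z‖ ≤ N * A * (N * d * B) ^ n := by
  refine (norm_wedgeVec_le hA _).trans ?_
  gcongr
  exact norm_koszulPow_le hB0 hB n

lemma wirtV_coeff (k : Fin d) {u : (Fin d → ℂ) → KoszulFibre N d} {z : Fin d → ℂ}
    (hu : DifferentiableAt ℝ u z) (S : Finset (Fin N)) (K : Finset (Fin d)) :
    wirtV k (fun z => u z S K) z = wirtV k u z S K :=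
  wirtV_clm k ((ContinuousLinearMap.proj K : (Finset (Fin d) → ℂ) →L[ℂ] ℂ).comp
    (ContinuousLinearMap.proj S : KoszulFibre N d →L[ℂ] _)) hu

lemma contDiffOn_coeff {u : (Fin d → ℂ) → KoszulFibre N d} (hu : ContDiffOn ℝ (⊤ : ℕ∞) u Ω)
    (S : Finset (Fin N)) (K : Finset (Fin d)) :
    ContDiffOn ℝ (⊤ : ℕ∞) (fun z => u z S K) Ω :=
  contDiffOn_pi.1 (contDiffOn_pi.1 hu S) K

/-- The components of a smooth Koszul form have the components of its classical `∂̄` as weak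
`∂̄`. -/
lemma weakDbar_coeff (hΩ : IsOpen Ω) {u : (Fin d → ℂ) → KoszulFibre N d}
    (hu : ContDiffOn ℝ (⊤ : ℕ∞) u Ω) (S : Finset (Fin N)) :
    WeakDbar Ω (fun K z => u z S K) (fun K z => dbarV u z S K) := by
  refine weakDbar_of_contDiffOn hΩ (fun K => contDiffOn_coeff hu S K) fun K z hz => ?_
  have hud : DifferentiableAt ℝ u z :=
    (hu.contDiffAt (hΩ.mem_nhds hz)).differentiableAt (by simp)
  simp only [dbarV, Finset.sum_apply, creForm_apply, cre_apply, smul_eq_mul]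
  rw [← Finset.sum_filter, Finset.filter_univ_mem]
  exact Finset.sum_congr rfl fun k _ => by rw [wirtV_coeff k hud]

end Tower

/-! ### Descent through the Koszul complex -/

section Descent

variable {N d : ℕ} {Ω : Set (Fin d → ℂ)}

lemma ae_norm_le_of_linfFormNorm_le {u : BarForm d} {R : ℝ} (hR : 0 ≤ R)
    (h : linfFormNorm Ω u ≤ ENNReal.ofReal R) (K : Finset (Fin d)) :
    ∀ᵐ z ∂volume.restrict Ω, ‖u K z‖ ≤ R := by
  have h1 : eLpNormEssSup (u K) (volume.restrict Ω) ≤ ENNReal.ofReal R := by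
    rw [← eLpNorm_exponent_top]
    exact (le_iSup (fun K => eLpNorm (u K) ∞ (volume.restrict Ω)) K).trans h
  filter_upwards [ae_le_eLpNormEssSup (f := u K) (μ := volume.restrict Ω)] with z hz
  have h2 := hz.trans h1
  rwa [← ofReal_norm, ENNReal.ofReal_le_ofReal_iff hR] at h2

lemma linfFormNorm_le_of_ae {u : BarForm d} {R : ℝ}
    (h : ∀ K, ∀ᵐ z ∂volume.restrict Ω, ‖u K z‖ ≤ R) : linfFormNorm Ω u ≤ ENNReal.ofReal R := by
  refine iSup_le fun K => ?_
  rw [eLpNorm_exponent_top]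
  exact eLpNormEssSup_le_of_ae_bound (h K)

/-- The coefficient with which the component at `insert s S` enters the contraction by `c` at
`S`. -/
noncomputable def contractCoeff (c : Fin N → ℂ) (S : Finset (Fin N)) (s : Fin N) : ℂ :=
  if s ∈ S then 0 else wedgeSign s (insert s S) * c s

lemma contract_apply_apply (c : Fin N → ℂ) (u : KoszulFibre N d) (S : Finset (Fin N))
    (K : Finset (Fin d)) :
    contract c u S K = ∑ s, contractCoeff c S s * u (insert s S) K := by
  simp only [contract_apply, Finset.sum_apply, Pi.smul_apply, ann_apply, contractCoeff]
  refine Finset.sum_congr rfl fun s _ => ?_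
  split_ifs
  · simp
  · simp only [Pi.smul_apply, smul_eq_mul, wedgeSign_insert_self]; ring

lemma norm_contractCoeff_le (c : Fin N → ℂ) (S : Finset (Fin N)) (s : Fin N) :
    ‖contractCoeff c S s‖ ≤ ‖c s‖ := by
  rw [contractCoeff]
  split_ifs
  · simp
  · rw [norm_mul, norm_wedgeSign, one_mul]

lemma differentiableOn_contractCoeff {f : Fin N → (Fin d → ℂ) → ℂ}
    (hf : ∀ s, DifferentiableOn ℂ (f s) Ω) (S : Finset (Fin N)) (s : Fin N) :
    DifferentiableOn ℂ (fun z => contractCoeff (fun s => f s z) S s) Ω := by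
  by_cases h : s ∈ S
  · simp only [contractCoeff, h, if_true]; exact differentiableOn_const _
  · simp only [contractCoeff, h, if_false]; exact (hf s).const_mul _

/-- The product of an `L^∞` function with a holomorphic function bounded by one. -/
lemma memLp_top_mul_of_holomorphic (hΩ : IsOpen Ω) {g u : (Fin d → ℂ) → ℂ}
    (hg : DifferentiableOn ℂ g Ω) (hg1 : ∀ z ∈ Ω, ‖g z‖ ≤ 1)
    (hu : MemLp u ∞ (volume.restrict Ω)) :
    MemLp (fun z => g z * u z) ∞ (volume.restrict Ω) := by
  have h1 : MemLp g ∞ (volume.restrict Ω) :=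
    memLp_top_of_bound (hg.continuousOn.aestronglyMeasurable hΩ.measurableSet) 1
      ((ae_restrict_iff' hΩ.measurableSet).2 (Filter.Eventually.of_forall hg1))
  exact hu.mul h1

/-- One step of the descent: from a `∂̄`-closed family `w` of degree `q + 1` whose contraction is
`p = ∂̄a`, pass to the `∂̄`-closed family `a - P u` of degree `q`, where `∂̄u = w`. -/
lemma exists_descent_step (hΩ : IsOpen Ω) {f : Fin N → (Fin d → ℂ) → ℂ}
    (hf : ∀ s, DifferentiableOn ℂ (f s) Ω) (hf1 : ∀ s, ∀ z ∈ Ω, ‖f s z‖ ≤ 1)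
    {E : ℕ → ℝ≥0} (hdbar : HasBoundedDbarSolutions Ω E) {q : ℕ} (hq : q + 1 ≤ d)
    {a p : Finset (Fin N) → BarForm d} {w : Finset (Fin N) → BarForm d} {α R : ℝ} (hR : 0 ≤ R)
    (ha : ∀ S, MemLinfForm Ω q (a S)) (haR : ∀ S K, ∀ z ∈ Ω, ‖a S K z‖ ≤ α)
    (hp : ∀ S K, MemLp (p S K) ∞ (volume.restrict Ω))
    (hap : ∀ S, WeakDbar Ω (a S) (p S))
    (hw : ∀ S, MemLinfForm Ω (q + 1) (w S)) (hw0 : ∀ S, WeakDbar Ω (w S) 0)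
    (hwR : ∀ S K, ∀ᵐ z ∂volume.restrict Ω, ‖w S K z‖ ≤ R)
    (hwp : ∀ z ∈ Ω, ∀ S K, contract (fun s => f s z) (fun S K => w S K z) S K = p S K z) :
    ∃ w' : Finset (Fin N) → BarForm d, (∀ S, MemLinfForm Ω q (w' S)) ∧
      (∀ S, WeakDbar Ω (w' S) 0) ∧
      (∀ S K, ∀ᵐ z ∂volume.restrict Ω, ‖w' S K z‖ ≤ α + N * (E (q + 1) * R)) ∧
      ∀ z, contract (fun s => f s z) (fun S K => w' S K z)
        = contract (fun s => f s z) (fun S K => a S K z) := by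
  have hsolve : ∀ S, ∃ u : BarForm d, MemLinfForm Ω q u ∧ WeakDbar Ω u (w S) ∧
      linfFormNorm Ω u ≤ (E (q + 1) : ℝ≥0∞) * linfFormNorm Ω (w S) := fun S =>
    hdbar (q + 1) (by omega) hq (w S) (hw S) (hw0 S)
  choose u hu huw huE using hsolve
  have huR : ∀ S K, ∀ᵐ z ∂volume.restrict Ω, ‖u S K z‖ ≤ E (q + 1) * R := fun S K => by
    refine ae_norm_le_of_linfFormNorm_le (by positivity) ((huE S).trans ?_) K
    rw [ENNReal.ofReal_mul (by positivity), ENNReal.ofReal_coe_nnreal]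
    gcongr
    exact linfFormNorm_le_of_ae (hwR S)
  -- the coefficients of `-P`
  let g : Finset (Fin N) → Fin N → (Fin d → ℂ) → ℂ :=
    fun S s z => -contractCoeff (fun s => f s z) S s
  have hg : ∀ S s, DifferentiableOn ℂ (g S s) Ω := fun S s =>
    (differentiableOn_contractCoeff hf S s).neg
  have hg1 : ∀ S s, ∀ z ∈ Ω, ‖g S s z‖ ≤ 1 := fun S s z hz => by
    rw [norm_neg]; exact (norm_contractCoeff_le _ S s).trans (hf1 s z hz)
  let w' : Finset (Fin N) → BarForm d := fun S =>
    a S + ∑ s, fun K z => g S s z * u (insert s S) K z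
  have hw'z : ∀ S K z, w' S K z
      = a S K z - contract (fun s => f s z) (fun S K => u S K z) S K := fun S K z => by
    simp only [w', g, contract_apply_apply, Pi.add_apply, Finset.sum_apply, neg_mul,
      Finset.sum_neg_distrib]
    ring
  have hmem : ∀ (v : Finset (Fin N) → BarForm d), (∀ S K, MemLp (v S K) ∞ (volume.restrict Ω)) →
      ∀ S s K, MemLp (fun z => g S s z * v (insert s S) K z) ∞ (volume.restrict Ω) :=
    fun v hv S s K => memLp_top_mul_of_holomorphic hΩ (hg S s) (hg1 S s) (hv _ K)
  have hu2 := hmem u fun S K => (hu S).2 K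
  have hw2 := hmem w fun S K => (hw S).2 K
  refine ⟨w', fun S => ⟨fun J hJ => ?_, fun J => ?_⟩, fun S => ?_, fun S K => ?_, fun z => ?_⟩
  · simp only [w', Pi.add_apply, Finset.sum_apply, (ha S).1 J hJ, (hu _).1 J hJ]
    ext z; simp
  · simp only [w', Pi.add_apply, Finset.sum_apply]
    exact ((ha S).2 J).add (memLp_finsetSum' _ fun s _ => hu2 S s J)
  · have h1 : WeakDbar Ω (∑ s, fun K z => g S s z * u (insert s S) K z)
        (∑ s, fun K z => g S s z * w (insert s S) K z) :=
      WeakDbar.sum _ (fun s _ => (huw (insert s S)).mul_holomorphic hΩ (hg S s)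
        (contDiffOn_real_of_holomorphic hΩ (hg S s))) (fun s _ K => hu2 S s K)
        (fun s _ K => hw2 S s K)
    have h2 : WeakDbar Ω (w' S) _ := (hap S).add h1 (fun K => (ha S).2 K)
      (fun K => by rw [Finset.sum_apply]; exact memLp_finsetSum' _ fun s _ => hu2 S s K)
      (hp S) (fun K => by rw [Finset.sum_apply]; exact memLp_finsetSum' _ fun s _ => hw2 S s K)
    refine h2.congr_ae fun K => ?_
    rw [Filter.EventuallyEq, ae_restrict_iff' hΩ.measurableSet]
    refine Filter.Eventually.of_forall fun z hz => ?_
    have h3 := hwp z hz S K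
    rw [contract_apply_apply] at h3
    simp only [g, Pi.add_apply, Finset.sum_apply, neg_mul, Finset.sum_neg_distrib, h3,
      Pi.zero_apply, add_neg_cancel]
  · have h1 : ∀ᵐ z ∂volume.restrict Ω, ∀ s, ‖u (insert s S) K z‖ ≤ E (q + 1) * R :=
      ae_all_iff.2 fun s => huR (insert s S) K
    filter_upwards [h1, ae_restrict_mem hΩ.measurableSet] with z hz hzΩ
    simp only [w', Pi.add_apply, Finset.sum_apply]
    refine (norm_add_le _ _).trans (add_le_add (haR S K z hzΩ) ?_)
    refine (norm_sum_le _ _).trans ?_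
    have h2 : ∀ s ∈ (Finset.univ : Finset (Fin N)), ‖g S s z * u (insert s S) K z‖
        ≤ E (q + 1) * R := fun s _ => by
      rw [norm_mul]
      calc _ ≤ 1 * (E (q + 1) * R) :=
            mul_le_mul (hg1 S s z hzΩ) (hz s) (norm_nonneg _) zero_le_one
        _ = _ := one_mul _
    refine (Finset.sum_le_card_nsmul _ _ _ h2).trans ?_
    simp
  · have e : (fun S K => w' S K z)
        = (fun S K => a S K z) - contract (fun s => f s z) (fun S K => u S K z) := by
      ext S K; exact hw'z S K z
    rw [e, map_sub, contract_contract, sub_zero]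

/-- The descent, from degree `d` to degree `q`. -/
lemma exists_descent (hΩ : IsOpen Ω) {f φ : Fin N → (Fin d → ℂ) → ℂ}
    (hf : ∀ s, DifferentiableOn ℂ (f s) Ω) (hf1 : ∀ s, ∀ z ∈ Ω, ‖f s z‖ ≤ 1)
    (hφ : ∀ s, ContDiffOn ℝ (⊤ : ℕ∞) (φ s) Ω) (hfφ : ∀ z ∈ Ω, ∑ s, f s z * φ s z = 1)
    {E : ℕ → ℝ≥0} (hdbar : HasBoundedDbarSolutions Ω E) {D : ℝ} (hD : 1 ≤ D)
    (hED : ∀ q, 1 ≤ q → q ≤ d → E q ≤ D) {T : ℝ} (hT : 0 ≤ T) (hN : 1 ≤ N)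
    (haT : ∀ q ≤ d, ∀ z ∈ Ω, ‖koszulForm φ q z‖ ≤ T / (N * D) ^ q)
    (hpb : ∀ q, ∃ B, ∀ z ∈ Ω, ‖koszulPow φ q z‖ ≤ B) (m : ℕ) :
    ∀ q, q + m = d → ∃ w : Finset (Fin N) → BarForm d, (∀ S, MemLinfForm Ω q (w S)) ∧
      (∀ S, WeakDbar Ω (w S) 0) ∧
      (∀ S K, ∀ᵐ z ∂volume.restrict Ω, ‖w S K z‖ ≤ (m + 1) * (T / (N * D) ^ q)) ∧
      ∀ z ∈ Ω, contract (fun s => f s z) (fun S K => w S K z) = koszulPow φ q z := by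
  have hN0 : (0 : ℝ) < N := by exact_mod_cast hN
  have hD0 : 0 < D := by linarith
  have hcoef : ∀ (v : KoszulFibre N d) S K, ‖v S K‖ ≤ ‖v‖ := fun v S K =>
    (norm_le_pi_norm (v S) K).trans (norm_le_pi_norm v S)
  have hmem : ∀ q ≤ d, ∀ S, MemLinfForm Ω q (fun K z => koszulForm φ q z S K) := by
    refine fun q hq S => ⟨fun J hJ => ?_, fun J => ?_⟩
    · ext z; exact hasFormDegree_koszulForm φ q z S J hJ
    · refine memLp_top_of_bound ((contDiffOn_coeff (contDiffOn_koszulForm hΩ hφ q) S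
        J).continuousOn.aestronglyMeasurable hΩ.measurableSet) (T / (N * D) ^ q) ?_
      rw [ae_restrict_iff' hΩ.measurableSet]
      exact Filter.Eventually.of_forall fun z hz => (hcoef _ S J).trans (haT q hq z hz)
  have hweak : ∀ q S, WeakDbar Ω (fun K z => koszulForm φ q z S K)
      (fun K z => koszulPow φ (q + 1) z S K) := fun q S => by
    refine (weakDbar_coeff hΩ (contDiffOn_koszulForm hΩ hφ q) S).congr_ae fun K => ?_
    rw [Filter.EventuallyEq, ae_restrict_iff' hΩ.measurableSet]
    exact Filter.Eventually.of_forall fun z hz => by rw [dbarV_koszulForm hΩ hφ q hz]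
  have hcontr : ∀ q, ∀ z ∈ Ω, contract (fun s => f s z) (koszulForm φ q z) = koszulPow φ q z :=
    fun q z hz => contract_koszulForm (hfφ z hz)
      (sum_mul_dbarCoeff_eq_zero hΩ hf hφ hfφ hz) q
  induction m with
  | zero =>
    rintro q hq
    obtain rfl : q = d := by omega
    refine ⟨fun S K z => koszulForm φ q z S K, hmem q le_rfl, fun S => ?_, fun S K => ?_,
      fun z hz => hcontr q z hz⟩
    · refine (hweak q S).congr_ae fun K => Filter.Eventually.of_forall fun z => ?_
      -- there are no forms of degree greater than the dimension
      refine hasFormDegree_koszulPow φ (q + 1) z S K ?_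
      have := Finset.card_le_univ K
      rw [Fintype.card_fin] at this
      omega
    · rw [ae_restrict_iff' hΩ.measurableSet]
      refine Filter.Eventually.of_forall fun z hz => ?_
      simpa using (hcoef _ S K).trans (haT q le_rfl z hz)
  | succ m ih =>
    rintro q hq
    obtain ⟨w, hw, hw0, hwR, hwp⟩ := ih (q + 1) (by omega)
    have hp : ∀ S K, MemLp (fun z => koszulPow φ (q + 1) z S K) ∞ (volume.restrict Ω) := by
      intro S K
      obtain ⟨B, hB⟩ := hpb (q + 1)
      refine memLp_top_of_bound ((contDiffOn_coeff (contDiffOn_koszulPow hΩ hφ (q + 1)) S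
        K).continuousOn.aestronglyMeasurable hΩ.measurableSet) B ?_
      rw [ae_restrict_iff' hΩ.measurableSet]
      exact Filter.Eventually.of_forall fun z hz => (hcoef _ S K).trans (hB z hz)
    obtain ⟨w', h1, h2, h3, h4⟩ := exists_descent_step hΩ hf hf1 hdbar (q := q) (by omega)
      (R := (m + 1) * (T / (N * D) ^ (q + 1))) (by positivity) (hmem q (by omega))
      (fun S K z hz => (hcoef _ S K).trans (haT q (by omega) z hz)) hp (hweak q)
      hw hw0 hwR (fun z hz S K => by rw [hwp z hz])
    refine ⟨w', h1, h2, fun S K => ?_, fun z hz => ?_⟩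
    · filter_upwards [h3 S K] with z hz
      refine hz.trans ?_
      have hE := hED (q + 1) (by omega) (by omega)
      calc T / (N * D) ^ q + N * (E (q + 1) * ((m + 1) * (T / (N * D) ^ (q + 1))))
          ≤ T / (N * D) ^ q + N * (D * ((m + 1) * (T / (N * D) ^ (q + 1)))) := by gcongr
        _ = (((m + 1 : ℕ) : ℝ) + 1) * (T / (N * D) ^ q) := by
          rw [pow_succ]; push_cast; field_simp; ring
    · rw [h4 z]; exact hcontr q z hz

/-- A bound holding almost everywhere on an open set holds everywhere for continuous functions. -/
lemma norm_le_of_ae_norm_le (hΩ : IsOpen Ω) {g : (Fin d → ℂ) → ℂ} (hg : ContinuousOn g Ω) {R : ℝ}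
    (h : ∀ᵐ z ∂volume.restrict Ω, ‖g z‖ ≤ R) : ∀ z ∈ Ω, ‖g z‖ ≤ R := by
  have h1 : (fun z => max ‖g z‖ R) =ᵐ[volume.restrict Ω] fun _ => R := by
    filter_upwards [h] with z hz using max_eq_right hz
  intro z hz
  exact max_eq_right_iff.1 (Measure.eqOn_open_of_ae_eq h1 hΩ (hg.norm.sup continuousOn_const)
    continuousOn_const hz)

/-- Holomorphic solutions of the Bézout equation from smooth ones. -/
lemma exists_holomorphic_bezout (hΩ : IsOpen Ω) {f φ : Fin N → (Fin d → ℂ) → ℂ}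
    (hf : ∀ s, DifferentiableOn ℂ (f s) Ω) (hf1 : ∀ s, ∀ z ∈ Ω, ‖f s z‖ ≤ 1)
    (hφ : ∀ s, ContDiffOn ℝ (⊤ : ℕ∞) (φ s) Ω) (hfφ : ∀ z ∈ Ω, ∑ s, f s z * φ s z = 1)
    {E : ℕ → ℝ≥0} (hdbar : HasBoundedDbarSolutions Ω E) {D : ℝ} (hD : 1 ≤ D)
    (hED : ∀ q, 1 ≤ q → q ≤ d → E q ≤ D) {T : ℝ} (hT : 0 ≤ T) (hN : 1 ≤ N)
    (haT : ∀ q ≤ d, ∀ z ∈ Ω, ‖koszulForm φ q z‖ ≤ T / (N * D) ^ q)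
    (hpb : ∀ q, ∃ B, ∀ z ∈ Ω, ‖koszulPow φ q z‖ ≤ B) :
    ∃ g : Fin N → (Fin d → ℂ) → ℂ, (∀ j, DifferentiableOn ℂ (g j) Ω) ∧
      (∀ z ∈ Ω, ∑ j, f j z * g j z = 1) ∧ ∀ j, ∀ z ∈ Ω, ‖g j z‖ ≤ (d + 1) * T := by
  obtain ⟨w, hw, hw0, hwR, hwp⟩ :=
    exists_descent hΩ hf hf1 hφ hfφ hdbar hD hED hT hN haT hpb d 0 (by omega)
  have hhol : ∀ j : Fin N, ∃ g : (Fin d → ℂ) → ℂ, DifferentiableOn ℂ g Ω ∧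
      g =ᵐ[volume.restrict Ω] w {j} ∅ := fun j => by
    refine exists_holomorphic_of_weak hΩ ((hw {j}).2 ∅) fun k ψ h1 h2 h3 => ?_
    have h := hw0 {j} {k} ψ h1 h2 h3
    simp only [Finset.sum_singleton, Finset.erase_singleton, Pi.zero_apply, zero_mul,
      integral_zero, neg_zero, wirtingerBar_eq_wirtV] at h
    refine (mul_eq_zero.1 h).resolve_left ?_
    exact norm_ne_zero_iff.1 (by rw [norm_wedgeSign]; exact one_ne_zero)
  choose g hg hgw using hhol
  refine ⟨g, hg, ?_, fun j => ?_⟩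
  · have h1 : (fun z => ∑ j, f j z * g j z) =ᵐ[volume.restrict Ω] fun _ => 1 := by
      filter_upwards [ae_all_iff.2 hgw, ae_restrict_mem hΩ.measurableSet] with z hz hzΩ
      have h2 : contract (fun s => f s z) (fun S K => w S K z) ∅ ∅ = 1 := by
        rw [hwp z hzΩ]; simp [koszulPow, koszulOne]
      rw [contract_apply_apply] at h2
      rw [← h2]
      refine Finset.sum_congr rfl fun j _ => ?_
      rw [hz j]
      simp [contractCoeff, wedgeSign, Finset.filter_singleton]
    refine fun z hz => Measure.eqOn_open_of_ae_eq h1 hΩ ?_ continuousOn_const hz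
    exact continuousOn_finsetSum _ fun j _ => (hf j).continuousOn.mul (hg j).continuousOn
  · refine norm_le_of_ae_norm_le hΩ (hg j).continuousOn ?_
    filter_upwards [hgw j, hwR {j} ∅] with z h1 h2
    rw [h1]; simpa using h2

end Descent

/-! ### Gradient bounds and the corona theorem with bounds -/

section Gradient

variable {d : ℕ} {Ω : Set (Fin d → ℂ)}

/-- The gradient of a function of class `A^1` on a bounded domain is bounded. -/
lemma bddAbove_grad (hbdd : Bornology.IsBounded Ω) {f : (Fin d → ℂ) → ℂ} (hf : IsA1 Ω f) :
    BddAbove (Set.range fun z : Ω => √(∑ k : Fin d, ‖fderiv ℂ f z (Pi.single k 1)‖ ^ 2)) := by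
  obtain ⟨-, -, F', hF', hF'f⟩ := hf
  obtain ⟨B, hB⟩ := hbdd.isCompact_closure.exists_bound_of_continuousOn hF'
  refine ⟨√(∑ k : Fin d, B ^ 2), ?_⟩
  rintro _ ⟨z, rfl⟩
  refine Real.sqrt_le_sqrt (Finset.sum_le_sum fun k _ => ?_)
  have h1 := hB z (subset_closure z.2)
  rw [hF'f z z.2] at h1
  have h2 : ‖fderiv ℂ f z (Pi.single k 1)‖ ≤ B := by
    refine ((fderiv ℂ f z).le_opNorm _).trans ?_
    rw [Pi.norm_single, norm_one, mul_one]
    exact h1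
  gcongr

lemma norm_fderiv_le_maxGradSupNorm (hbdd : Bornology.IsBounded Ω) {N : ℕ}
    {f : Fin N → (Fin d → ℂ) → ℂ} (hf : ∀ j : Fin N, (j : ℕ) + 1 < N → IsA1 Ω (f j)) {j : Fin N}
    (hj : (j : ℕ) + 1 < N) {z : Fin d → ℂ} (hz : z ∈ Ω) (k : Fin d) :
    ‖fderiv ℂ (f j) z (Pi.single k 1)‖ ≤ maxGradSupNorm Ω f := calc
  _ ≤ √(∑ k : Fin d, ‖fderiv ℂ (f j) z (Pi.single k 1)‖ ^ 2) :=
    Real.le_sqrt_of_sq_le (Finset.single_le_sum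
      (f := fun k : Fin d => ‖fderiv ℂ (f j) z (Pi.single k 1)‖ ^ 2)
      (fun i _ => by positivity) (Finset.mem_univ k))
  _ ≤ gradSupNorm Ω (f j) := le_ciSup (bddAbove_grad hbdd (hf j hj)) ⟨z, hz⟩
  _ ≤ maxGradSupNorm Ω f :=
    le_ciSup (f := fun j : {j : Fin N // (j : ℕ) + 1 < N} => gradSupNorm Ω (f j))
      (Set.finite_range _).bddAbove ⟨j, hj⟩

lemma maxGradSupNorm_nonneg {N : ℕ} (f : Fin N → (Fin d → ℂ) → ℂ) : 0 ≤ maxGradSupNorm Ω f :=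
  Real.iSup_nonneg fun _ => Real.iSup_nonneg fun _ => Real.sqrt_nonneg _

end Gradient

theorem theorem3 {d : ℕ} (Ω : Set (Fin d → ℂ))
    (hopen : IsOpen Ω) (hconn : IsConnected Ω) (hbdd : Bornology.IsBounded Ω)
    (hpsc : IsPseudoconvex Ω)
    (E : ℕ → ℝ≥0) (hdbar : HasBoundedDbarSolutions Ω E) :
    ∃ C : ℝ, 0 < C ∧
      ∀ (N : ℕ) (_ : 2 ≤ N) (f : Fin N → (Fin d → ℂ) → ℂ) (δ : ℝ),
        (∀ j : Fin N, (j : ℕ) + 1 < N → IsA1 Ω (f j)) →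
        (∀ j : Fin N, (j : ℕ) + 1 = N → IsHInfty Ω (f j)) →
        (∀ j : Fin N, ∀ z ∈ Ω, ‖f j z‖ ≤ 1) →
        0 < δ → (∀ z ∈ Ω, δ ≤ ∑ j : Fin N, ‖f j z‖) →
        ∃ g : Fin N → (Fin d → ℂ) → ℂ,
          (∀ j : Fin N, IsHInfty Ω (g j)) ∧
          (∀ z ∈ Ω, ∑ j : Fin N, f j z * g j z = 1) ∧
          ∀ j : Fin N, supNorm Ω (g j) ≤
            C * (N : ℝ) ^ (4 * d + 2) *
              max (maxGradSupNorm Ω f) (δ ^ 2 / (N : ℝ) ^ 4) ^ d / δ ^ (2 * d + 1) := by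
  obtain ⟨c, hc, hbez⟩ := exists_smooth_bezout
  obtain ⟨D, hD, hED⟩ : ∃ D : ℝ, 1 ≤ D ∧ ∀ q, 1 ≤ q → q ≤ d → E q ≤ D := by
    refine ⟨1 + ∑ q ∈ Finset.range (d + 1), (E q : ℝ), ?_, fun q _ hq => ?_⟩
    · linarith [Finset.sum_nonneg (s := Finset.range (d + 1)) fun q _ => (E q).coe_nonneg]
    · have := Finset.single_le_sum (f := fun q => (E q : ℝ)) (fun q _ => (E q).coe_nonneg)
        (Finset.mem_range.2 (Nat.lt_succ_of_le hq))
      linarith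
  have hc0 : 0 < c := by linarith
  have hD0 : 0 < D := by linarith
  set c' : ℝ := c * D * (d + 1) with hc'_def
  have hd0 : (0 : ℝ) ≤ d := d.cast_nonneg
  have hc' : 1 ≤ c' := by
    have h1 : 1 ≤ c * D := one_le_mul_of_one_le_of_one_le hc hD
    exact one_le_mul_of_one_le_of_one_le h1 (by linarith)
  refine ⟨(d + 1) * (c * c' ^ d), by positivity, ?_⟩
  intro N hN f δ hA1 hH hf1 hδ hfδ
  have hN1 : 1 ≤ N := by omega
  have hN0 : (0 : ℝ) < N := by exact_mod_cast hN1
  have hf : ∀ j, DifferentiableOn ℂ (f j) Ω := fun j => by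
    rcases lt_or_eq_of_le (Nat.succ_le_of_lt j.2) with h | h
    · exact (hA1 j h).1
    · exact (hH j h).1
  set M := maxGradSupNorm Ω f with hM_def
  have hM : 0 ≤ M := maxGradSupNorm_nonneg f
  obtain ⟨φ, hφ, hfφ, hφA, hφB⟩ := hbez hopen f ⟨N - 1, by omega⟩ δ M hδ hM hf
    (fun j hj z hz k => norm_fderiv_le_maxGradSupNorm hbdd hA1
      (by have : (j : ℕ) ≠ N - 1 := fun h => hj (Fin.ext h)
          omega) hz k) hfδ
  set Y : ℝ := (N : ℝ) ^ 4 / δ ^ 2 * max M (δ ^ 2 / (N : ℝ) ^ 4) with hY_def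
  have hY1 : 1 ≤ Y := by
    calc (1 : ℝ) = (N : ℝ) ^ 4 / δ ^ 2 * (δ ^ 2 / (N : ℝ) ^ 4) := by field_simp
      _ ≤ Y := by rw [hY_def]; gcongr; exact le_max_right _ _
  have hYM : (N : ℝ) ^ 4 / δ ^ 2 * M ≤ Y := by rw [hY_def]; gcongr; exact le_max_left _ _
  set T : ℝ := c * (N : ℝ) ^ 2 / δ * (c' ^ d * Y ^ d) with hT_def
  have hT : 0 ≤ T := by positivity
  have hA0 : 0 ≤ c * N / δ := by positivity
  have hB0 : 0 ≤ c * N ^ 2 * M / δ ^ 2 := by positivity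
  have haT : ∀ q ≤ d, ∀ z ∈ Ω, ‖koszulForm φ q z‖ ≤ T / (N * D) ^ q := fun q hq z hz => by
    refine (norm_koszulForm_le hA0 (fun s => hφA s z hz) hB0
      (fun s k => hφB s k z hz) q).trans ?_
    rw [le_div_iff₀ (by positivity)]
    have h1 : (N : ℝ) * d * (c * N ^ 2 * M / δ ^ 2) * (N * D) ≤ c' * Y := by
      calc (N : ℝ) * d * (c * N ^ 2 * M / δ ^ 2) * (N * D)
          = c * D * d * ((N : ℝ) ^ 4 / δ ^ 2 * M) := by ring
        _ ≤ c * D * (d + 1) * Y := by gcongr; linarith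
        _ = c' * Y := by rw [hc'_def]
    calc (N : ℝ) * (c * N / δ) * (N * d * (c * N ^ 2 * M / δ ^ 2)) ^ q * (N * D) ^ q
        = c * (N : ℝ) ^ 2 / δ * ((N : ℝ) * d * (c * N ^ 2 * M / δ ^ 2) * (N * D)) ^ q := by
          rw [mul_pow _ ((N : ℝ) * D)]; ring
      _ ≤ c * (N : ℝ) ^ 2 / δ * (c' * Y) ^ q := by gcongr
      _ ≤ c * (N : ℝ) ^ 2 / δ * (c' * Y) ^ d := by
          gcongr
          exact one_le_mul_of_one_le_of_one_le hc' hY1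
      _ = T := by rw [hT_def, mul_pow]
  obtain ⟨g, hg, hfg, hgT⟩ := exists_holomorphic_bezout hopen hf hf1 hφ hfφ hdbar hD hED hT hN1 haT
    fun q => ⟨_, fun z hz => norm_koszulPow_le hB0 (fun s k => hφB s k z hz) q⟩
  refine ⟨g, fun j => ⟨hg j, _, hgT j⟩, hfg, fun j => ?_⟩
  have hfin : (d + 1) * T = (d + 1) * (c * c' ^ d) * (N : ℝ) ^ (4 * d + 2) *
      max M (δ ^ 2 / (N : ℝ) ^ 4) ^ d / δ ^ (2 * d + 1) := by
    rw [hT_def, hY_def, mul_pow _ (max _ _), div_pow, ← pow_mul, ← pow_mul]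
    field_simp
    ring
  rw [← hfin]
  exact Real.iSup_le (fun z => hgT j z z.2) (by positivity)
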